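/- Let $d\ge 1$, let $\Omega\subset\mathbb{R}^d$ be open and bounded, and let $\mathbb{S}^2\subset\mathbb{R}^3$ be the unit sphere with the great-circle (geodesic) distance $d_{\mathbb{S}^2}$. Let $\mathcal{P}(\mathbb{S}^2)$ be the set of Borel probability measures on $\mathbb{S}^2$, with the Wasserstein metric $$W_1(\mu,\nu)=\inf\Big\{\int d_{\mathbb{S}^2}(y,z)\,d\gamma(y,z)\ :\ \gamma\in\mathcal{P}(\mathbb{S}^2\times\mathbb{S}^2)\text{ with marginals }\mu\text{ and }\nu\Big\}.$$ Fix $x_0\in\mathbb{S}^2$ and let $\operatorname{Lip}_0(\mathbb{S}^2)$ be the space of Lipschitz functions $q:\mathbb{S}^2\to\mathbb{R}$ with $q(x_0)=0$, normed by the Lipschitz constant $[q]_{\mathrm{Lip}}$. Given a norm $\|\cdot\|$ on $[\operatorname{Lip}_0(\mathbb{S}^2)]^d$, define for $u:\Omega\to\mathcal{P}(\mathbb{S}^2)$ $$\operatorname{TV}_{KR}(u)=\sup\Big\{\int_\Omega\int_{\mathbb{S}^2}-\operatorname{div}p(x)(z)\,du_x(z)\,dx\ :\ p\in C_c^1\big(\Omega,[\operatorname{Lip}_0(\mathbb{S}^2)]^d\big),\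 \|p(x)\|\le 1\text{ for all }x\in\Omega\Big\},$$ where $\operatorname{div}p=\sum_{i=1}^d\partial_i p_i$. Let $U\subset\Omega$ be a measurable set with compact closure $\overline{U}\subset\Omega$ and with $C^1$ boundary: near each point of $\partial U$ there is a $C^1$ function on a hyperplane such that, near this point, $U$ contains all points strictly on one side of its graph and no points strictly on the other side. Let $u^+,u^-\in\mathcal{P}(\mathbb{S}^2)$ and let $u(x)=u^+$ for $x\in U$ and $u(x)=u^-$ for $x\in\Omega\setminus U$. Then $$\operatorname{TV}_{KR}(u)=\mathcal{H}^{d-1}(\partial U)\cdot W_1(u^+,u^-),$$ both when the norm on $[\operatorname{Lip}_0(\mathbb{S}^2)]^d$ is the coupled Lipschitz norm $$[p]_{\operatorname{Lip}(\mathbb{S}^2,\mathbb{R}^d)}=\sup_{z\ne z'}\frac{\|p(z)-p(z')\|_2}{d_{\mathbb{S}^2}(z,z')}$$ and when it is the product norm $\big(\sum_{i=1}^d[p_i]_{\mathrm{Lip}}^2\big)^{1/2}$. Here $\mathcal{H}^{d-1}$ is the $(d-1)$-dimensional Hausdorff measure, normalised to agree with Lebesgue measure on $\mathbb{R}^{d-1}$.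 -/

import Mathlib

open MeasureTheory
open scoped ENNReal InnerProductSpace

noncomputable section

/-- The Lipschitz constant `sup_{z ≠ z'} ‖f z - f z'‖ / d(z, z')` of a Lipschitz function
(pairs with `z = z'` contribute `0 / 0 = 0`). -/
def lipConst {X F : Type*} [MetricSpace X] [NormedAddCommGroup F] (f : X → F) : ℝ :=
  ⨆ q : X × X, ‖f q.1 - f q.2‖ / dist q.1 q.2

theorem lipConst_bddAbove {X F : Type*} [MetricSpace X] [NormedAddCommGroup F] {f : X → F}
    (hf : ∃ K, LipschitzWith K f) :
    BddAbove (Set.range fun q : X × X => ‖f q.1 - f q.2‖ / dist q.1 q.2) := by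
  obtain ⟨K, hK⟩ := hf
  refine ⟨K, ?_⟩
  rintro _ ⟨q, rfl⟩
  refine div_le_of_le_mul₀ dist_nonneg K.2 ?_
  rw [← dist_eq_norm]
  exact hK.dist_le_mul _ _

theorem lipConst_nonneg {X F : Type*} [MetricSpace X] [NormedAddCommGroup F] (f : X → F) :
    0 ≤ lipConst f :=
  Real.iSup_nonneg fun _ => by positivity

theorem norm_sub_le_lipConst {X F : Type*} [MetricSpace X] [NormedAddCommGroup F] {f : X → F}
    (hf : ∃ K, LipschitzWith K f) (x y : X) : ‖f x - f y‖ ≤ lipConst f * dist x y := by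
  rcases eq_or_ne x y with rfl | h
  · simp
  · rw [← div_le_iff₀ (dist_pos.2 h)]
    exact le_ciSup (lipConst_bddAbove hf) (x, y)

theorem lipConst_le {X F : Type*} [MetricSpace X] [NormedAddCommGroup F] {f : X → F} {C : ℝ}
    (hC : 0 ≤ C) (h : ∀ x y, ‖f x - f y‖ ≤ C * dist x y) : lipConst f ≤ C :=
  Real.iSup_le (fun _ => div_le_of_le_mul₀ dist_nonneg hC (h _ _)) hC

/-- The vector space of real Lipschitz functions on `X` that vanish at `x₀`. -/
def lip0Submodule {X : Type*} [MetricSpace X] (x₀ : X) : Submodule ℝ (X → ℝ) where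
  carrier := {f | f x₀ = 0 ∧ ∃ K, LipschitzWith K f}
  zero_mem' := ⟨rfl, 0, LipschitzWith.const 0⟩
  add_mem' := by
    rintro f g ⟨hf, K, hK⟩ ⟨hg, L, hL⟩
    exact ⟨by simp [hf, hg], K + L, hK.add hL⟩
  smul_mem' := by
    rintro c f ⟨hf, K, hK⟩
    exact ⟨by simp [hf], ‖c‖₊ * K, (lipschitzWith_smul c).comp hK⟩

/-- The space `Lip₀(X)`: the functions of `lip0Submodule x₀`, as a type of its own that carries
the Lipschitz norm and not the topology of pointwise convergence. -/
def Lip0 {X : Type*} [MetricSpace X] (x₀ : X) : Type _ := lip0Submodule x₀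

instance Lip0.instAddCommGroup {X : Type*} [MetricSpace X] (x₀ : X) : AddCommGroup (Lip0 x₀) :=
  inferInstanceAs (AddCommGroup (lip0Submodule x₀))

instance Lip0.instModule {X : Type*} [MetricSpace X] (x₀ : X) : Module ℝ (Lip0 x₀) :=
  inferInstanceAs (Module ℝ (lip0Submodule x₀))

instance Lip0.instCoeFun {X : Type*} [MetricSpace X] (x₀ : X) :
    CoeFun (Lip0 x₀) fun _ => X → ℝ := ⟨fun f => f.1⟩

instance Lip0.instNorm {X : Type*} [MetricSpace X] (x₀ : X) : Norm (Lip0 x₀) :=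
  ⟨fun f => lipConst f⟩

theorem Lip0.normCore {X : Type*} [MetricSpace X] (x₀ : X) :
    NormedSpace.Core ℝ (Lip0 x₀) where
  norm_nonneg f := lipConst_nonneg _
  norm_smul c f := by
    change (⨆ q : X × X, ‖c * f q.1 - c * f q.2‖ / dist q.1 q.2)
      = ‖c‖ * ⨆ q : X × X, ‖f q.1 - f q.2‖ / dist q.1 q.2
    rw [Real.mul_iSup_of_nonneg (norm_nonneg c)]
    refine iSup_congr fun q => ?_
    rw [← mul_sub, norm_mul, mul_div_assoc]
  norm_triangle f g := by
    refine lipConst_le (add_nonneg (lipConst_nonneg _) (lipConst_nonneg _)) fun x y => ?_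
    have h1 := norm_sub_le_lipConst f.2.2 x y
    have h2 := norm_sub_le_lipConst g.2.2 x y
    change ‖(f x + g x) - (f y + g y)‖ ≤ (lipConst f + lipConst g) * dist x y
    rw [add_sub_add_comm, add_mul]
    exact (norm_add_le _ _).trans (add_le_add h1 h2)
  norm_eq_zero_iff f := by
    constructor
    · intro h
      refine Subtype.ext (funext fun x => ?_)
      have h1 := norm_sub_le_lipConst f.2.2 x x₀
      have h0 : f x₀ = 0 := f.2.1
      have h2 : lipConst f = 0 := h
      rw [h2, zero_mul, h0, sub_zero] at h1
      exact norm_le_zero_iff.1 h1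
    · rintro rfl
      change (⨆ q : X × X, ‖(0 : ℝ) - 0‖ / dist q.1 q.2) = 0
      simp

instance Lip0.instNormedAddCommGroup {X : Type*} [MetricSpace X] (x₀ : X) :
    NormedAddCommGroup (Lip0 x₀) := NormedAddCommGroup.ofCore (Lip0.normCore x₀)

instance Lip0.instNormedSpace {X : Type*} [MetricSpace X] (x₀ : X) :
    NormedSpace ℝ (Lip0 x₀) := NormedSpace.ofCore (Lip0.normCore x₀)

/-- The coupled norm `sup_{z ≠ z'} ‖p(z) - p(z')‖₂ / d(z, z')` on `Lip₀(X)^d`. -/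
def coupledLipNorm {X : Type*} [MetricSpace X] {x₀ : X} {d : ℕ} (p : Fin d → Lip0 x₀) : ℝ :=
  lipConst fun z : X => (WithLp.toLp 2 fun i => p i z : EuclideanSpace ℝ (Fin d))

/-- The product norm `(∑ i, [p i]_Lip ^ 2) ^ (1 / 2)` on `Lip₀(X)^d`. -/
def productLipNorm {X : Type*} [MetricSpace X] {x₀ : X} {d : ℕ} (p : Fin d → Lip0 x₀) : ℝ :=
  Real.sqrt (∑ i, ‖p i‖ ^ 2)

/-- The divergence `∑ i, ∂ᵢ pᵢ` of a `Lip₀(X)^d`-valued vector field on `ℝ^d`; the derivative is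
taken in the norm of `Lip₀(X)`. -/
def lipDiv {X : Type*} [MetricSpace X] {x₀ : X} {d : ℕ}
    (p : EuclideanSpace ℝ (Fin d) → Fin d → Lip0 x₀) (x : EuclideanSpace ℝ (Fin d)) : Lip0 x₀ :=
  ∑ i, fderiv ℝ p x (EuclideanSpace.single i 1) i

/-- The total variation on `Ω` of a measure-valued function `u`, for a given norm `N` on
`Lip₀(X)^d`: the supremum of `∫_Ω ⟨- div p(x), u(x)⟩ dx` over all `p ∈ C_c^1(Ω, Lip₀(X)^d)` with
`N (p x) ≤ 1` on `Ω`. A function in `C_c^1(Ω, ·)` is identified with its extension by zero. -/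
def TVKR {X : Type*} [MetricSpace X] [MeasurableSpace X] {d : ℕ}
    (Ω : Set (EuclideanSpace ℝ (Fin d))) (x₀ : X) (N : (Fin d → Lip0 x₀) → ℝ)
    (u : EuclideanSpace ℝ (Fin d) → ProbabilityMeasure X) : EReal :=
  ⨆ (p : EuclideanSpace ℝ (Fin d) → Fin d → Lip0 x₀) (_ : ContDiff ℝ 1 p)
    (_ : HasCompactSupport p) (_ : tsupport p ⊆ Ω) (_ : ∀ x ∈ Ω, N (p x) ≤ 1),
    ((∫ x in Ω, ∫ z, (-lipDiv p x) z ∂(u x : Measure X) : ℝ) : EReal)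

/-- The Wasserstein metric `W₁`: the infimum of `∫ d(x, y) dγ(x, y)` over all probability measures
`γ` on `X × X` with marginals `μ` and `ν`. -/
def wasserstein1 {X : Type*} [MetricSpace X] [MeasurableSpace X]
    (μ ν : ProbabilityMeasure X) : ℝ≥0∞ :=
  ⨅ (γ : ProbabilityMeasure (X × X)) (_ : (γ : Measure (X × X)).fst = μ)
    (_ : (γ : Measure (X × X)).snd = ν),
    ∫⁻ q, edist q.1 q.2 ∂(γ : Measure (X × X))

/-- The unit sphere of `ℝ³`, to be equipped with the geodesic distance. -/
def S2 : Type := Metric.sphere (0 : EuclideanSpace ℝ (Fin 3)) 1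

/-- The distance of two points of the sphere is the angle between them, that is, the length of the
great circle arc through them. -/
instance S2.instMetricSpace : MetricSpace S2 where
  dist x y := InnerProductGeometry.angle x.1 y.1
  dist_self x := InnerProductGeometry.angle_self (by
    intro h
    have := mem_sphere_zero_iff_norm.1 x.2
    simp [h] at this)
  dist_comm x y := InnerProductGeometry.angle_comm _ _
  dist_triangle x y z := InnerProductGeometry.angle_le_angle_add_angle _ _ _
  eq_of_dist_eq_zero {x y} h := by
    have hx := mem_sphere_zero_iff_norm.1 x.2
    have hy := mem_sphere_zero_iff_norm.1 y.2
    obtain ⟨-, r, hr, h1⟩ := InnerProductGeometry.angle_eq_zero_iff.1 h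
    rw [h1, norm_smul, hx, Real.norm_eq_abs, abs_of_pos hr, mul_one] at hy
    rw [hy, one_smul] at h1
    exact Subtype.ext h1.symm

instance S2.instMeasurableSpace : MeasurableSpace S2 := borel S2

instance S2.instBorelSpace : BorelSpace S2 := ⟨rfl⟩

/-- `U` has `C^1` boundary: near each boundary point there are a unit vector `e` and a `C^1`
function `g` on the hyperplane orthogonal to `e`, such that `U` is the region below the graph of
`g` in direction `e`. Points on the graph may or may not belong to `U`, so that the notion applies
to open, closed and general sets alike. -/
def HasC1Boundary {d : ℕ} (U : Set (EuclideanSpace ℝ (Fin d))) : Prop :=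
  ∀ x ∈ frontier U, ∃ e : EuclideanSpace ℝ (Fin d), ‖e‖ = 1 ∧
    ∃ g : (ℝ ∙ e)ᗮ → ℝ, ContDiff ℝ 1 g ∧ ∃ r > 0, ∀ y ∈ Metric.ball x r,
      (⟪e, y⟫_ℝ < g ((ℝ ∙ e)ᗮ.orthogonalProjectionOnto y) → y ∈ U) ∧
      (g ((ℝ ∙ e)ᗮ.orthogonalProjectionOnto y) < ⟪e, y⟫_ℝ → y ∉ U)

end

noncomputable section

open Module Set Topology Filter
open scoped NNReal CompactlySupported

set_option linter.unusedSectionVars false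

/-! On `Ω` write `u = u⁻ + 1_U (u⁺ - u⁻)`. The spatially constant part `u⁻` contributes nothing when
tested with the divergence of a compactly supported field, so the functional equals minus the
integral over `U` of the divergence of the ordinary vector field `φᵢ(x) = ∫ pᵢ(x) d(u⁺ - u⁻)`
(`integral_lipDiv_eq`). By the divergence theorem this is a flux of `φ` through `∂U`.

Upper bound: if `p(x)` has coupled norm at most 1, every combination `∑ aᵢ pᵢ(x)` with `|a| = 1` is
1-Lipschitz, hence `|φ(x)| ≤ W₁(u⁺, u⁻)` (`norm_integralCLM_sub_le`), and the flux is at most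
`ℋ^{d-1}(∂U) W₁` (`HasC1Boundary.integral_euclideanDiv_le`).

Lower bound: take `p(x) = -ψ(x) q` with a single potential `q`; its product norm is `|ψ(x)| ‖q‖`.
Duality supplies `q` with `∫ q d(u⁺ - u⁻)` close to `W₁` (`exists_lip0_le_integral_sub`), and
`HasC1Boundary.exists_le_integral_euclideanDiv` supplies `ψ` with flux close to `ℋ^{d-1}(∂U)`. The
coupled norm is at most the product norm, so the upper bound for the former and the lower bound for
the latter settle both cases.

Two tools carry this. Kantorovich–Rubinstein duality comes from M. Riesz extension of a positive
functional, followed by the Riesz–Markov–Kakutani theorem. The divergence theorem comes from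
straightening a graph by a volume-preserving shear, while the area formula identifies `√(1 + |∇g|²)
dy` with Hausdorff measure. No global normal is constructed: local normals and a partition of unity
suffice. -/

/-! ### Kantorovich–Rubinstein duality -/

/-- Rescale by `t⁻¹`. For `t = 0` the function is constant and both integrals agree. -/
theorem integral_sub_integral_le_mul_of_lipschitzWith {X : Type*} [MetricSpace X]
    [MeasurableSpace X] {μ ν : ProbabilityMeasure X} {D : ℝ}
    (hD : ∀ q : X → ℝ, LipschitzWith 1 q → ∫ x, q x ∂(μ : Measure X) - ∫ x, q x ∂(ν : Measure X) ≤ D)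
    {t : ℝ} (ht : 0 ≤ t) {q : X → ℝ} (hq : ∀ x y, q x ≤ q y + t * dist x y) :
    ∫ x, q x ∂(μ : Measure X) - ∫ x, q x ∂(ν : Measure X) ≤ t * D := by
  rcases ht.eq_or_lt with rfl | ht
  · obtain ⟨x₁⟩ : Nonempty X := (μ : Measure X).nonempty_of_neZero
    have hc : q = fun _ => q x₁ := by
      ext x
      have h1 := hq x x₁
      have h2 := hq x₁ x
      linarith
    rw [hc]
    simp
  · have h := hD (fun x => t⁻¹ * q x) (by
      refine LipschitzWith.of_le_add fun x y => ?_
      have h1 := mul_le_mul_of_nonneg_left (hq x y) (inv_pos.2 ht).le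
      rwa [mul_add, inv_mul_cancel_left₀ ht.ne'] at h1)
    rw [integral_const_mul, integral_const_mul, ← mul_sub, inv_mul_le_iff₀ ht] at h
    exact h

/-- Weak form of the reduction to one potential: if `f ⊕ g + t d ≥ 0`, then
`∫ f dμ + ∫ g dν + t D ≥ 0`. -/
theorem integral_add_integral_add_nonneg {X : Type*} [MetricSpace X] [CompactSpace X]
    [MeasurableSpace X] [BorelSpace X] {μ ν : ProbabilityMeasure X} {D : ℝ}
    (hD : ∀ q : X → ℝ, LipschitzWith 1 q → ∫ x, q x ∂(μ : Measure X) - ∫ x, q x ∂(ν : Measure X) ≤ D)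
    {t : ℝ} (ht : 0 ≤ t) {f g : C(X, ℝ)} (h : ∀ x y, 0 ≤ f x + g y + t * dist x y) :
    0 ≤ ∫ x, f x ∂(μ : Measure X) + ∫ x, g x ∂(ν : Measure X) + t * D := by
  obtain ⟨x₁⟩ : Nonempty X := (μ : Measure X).nonempty_of_neZero
  -- This inf-convolution is `t`-Lipschitz and lies between the two potentials: `-f ≤ q ≤ g`.
  -- Replacing both by `q` can only decrease the left-hand sum.
  set q : X → ℝ := fun x => ⨅ y, (t * dist x y + g y) with hq
  have hbdd : ∀ x, BddBelow (Set.range fun y => t * dist x y + g y) := by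
    rintro x
    refine ⟨-f x, ?_⟩
    rintro _ ⟨y, rfl⟩
    have := h x y
    dsimp only
    linarith
  have hqg : ∀ x, q x ≤ g x := fun x => by
    simpa using ciInf_le (hbdd x) x
  have hfq : ∀ x, -f x ≤ q x := fun x => by
    have : Nonempty X := ⟨x₁⟩
    refine le_ciInf fun y => ?_
    have := h x y
    linarith
  have hql : ∀ x y, q x ≤ q y + t * dist x y := fun x y => by
    have : Nonempty X := ⟨x₁⟩
    rw [← sub_le_iff_le_add]
    refine le_ciInf fun z => ?_
    rw [sub_le_iff_le_add]
    refine (ciInf_le (hbdd x) z).trans ?_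
    have := mul_le_mul_of_nonneg_left (dist_triangle x y z) ht
    linarith
  have hqc : Continuous q := by
    refine (LipschitzWith.of_le_add_mul ⟨t, ht⟩ fun x y => hql x y).continuous
  have hint : ∀ (m : ProbabilityMeasure X) (k : X → ℝ), Continuous k →
      Integrable k (m : Measure X) := fun m k hk =>
    hk.integrable_of_hasCompactSupport (HasCompactSupport.of_compactSpace k)
  have h1 := integral_mono (f := fun x => -f x) (hint μ _ f.continuous.neg) (hint μ q hqc) hfq
  have h2 := integral_mono (hint ν q hqc) (hint ν _ g.continuous) hqg
  have h3 := integral_sub_integral_le_mul_of_lipschitzWith hD ht hql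
  rw [integral_neg] at h1
  linarith

/-- **Kantorovich–Rubinstein duality** on a compact metric space (the non-trivial inequality). -/
theorem wasserstein1_le_of_forall_lipschitzWith {X : Type*} [MetricSpace X] [CompactSpace X]
    [MeasurableSpace X] [BorelSpace X] {μ ν : ProbabilityMeasure X} {D : ℝ}
    (hD : ∀ q : X → ℝ, LipschitzWith 1 q →
      ∫ x, q x ∂(μ : Measure X) - ∫ x, q x ∂(ν : Measure X) ≤ D) :
    wasserstein1 μ ν ≤ ENNReal.ofReal D := by
  have hint : ∀ (m : ProbabilityMeasure X) (k : C(X, ℝ)), Integrable k (m : Measure X) :=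
    fun m k => k.continuous.integrable_of_hasCompactSupport (HasCompactSupport.of_compactSpace k)
  let c : C(X × X, ℝ) := ⟨fun q => dist q.1 q.2, continuous_dist⟩
  let P₁ : C(X, ℝ) →ₗ[ℝ] C(X × X, ℝ) :=
    { toFun := fun f => f.comp ⟨Prod.fst, continuous_fst⟩
      map_add' := fun _ _ => rfl
      map_smul' := fun _ _ => rfl }
  let P₂ : C(X, ℝ) →ₗ[ℝ] C(X × X, ℝ) :=
    { toFun := fun f => f.comp ⟨Prod.snd, continuous_snd⟩
      map_add' := fun _ _ => rfl
      map_smul' := fun _ _ => rfl }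
  let I : ProbabilityMeasure X → C(X, ℝ) →ₗ[ℝ] ℝ := fun m =>
    { toFun := fun f => ∫ x, f x ∂(m : Measure X)
      map_add' := fun f g => integral_add (hint m f) (hint m g)
      map_smul' := fun r f => integral_const_mul r _ }
  -- The coordinate `t` carries the cost constraint, so that the bound on the cost is part of the
  -- positivity to be extended. On the subspace `k = 0` the functional is prescribed as `∫ f dμ + ∫
  -- g dν + t D`; its extension to `(0, k)` will be integration against the coupling.
  let s : PointedCone ℝ ((C(X, ℝ) × C(X, ℝ) × ℝ) × C(X × X, ℝ)) :=
    { carrier := {e | 0 ≤ e.1.2.2 ∧ ∀ x y, 0 ≤ e.1.1 x + e.1.2.1 y + e.1.2.2 * dist x y + e.2 (x, y)}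
      zero_mem' := by simp
      add_mem' := by
        rintro a b ⟨ha, ha'⟩ ⟨hb, hb'⟩
        refine ⟨add_nonneg ha hb, fun x y => ?_⟩
        have h := add_nonneg (ha' x y) (hb' x y)
        simp only [Prod.fst_add, Prod.snd_add, ContinuousMap.add_apply]
        linarith
      smul_mem' := by
        rintro r a ⟨ha, ha'⟩
        refine ⟨mul_nonneg r.2 ha, fun x y => ?_⟩
        have h := mul_nonneg r.2 (ha' x y)
        change 0 ≤ (r : ℝ) * a.1.1 x + (r : ℝ) * a.1.2.1 y + ((r : ℝ) * a.1.2.2) * dist x y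
          + (r : ℝ) * a.2 (x, y)
        linarith }
  let F₀ : ((C(X, ℝ) × C(X, ℝ) × ℝ) × C(X × X, ℝ)) →ₗ[ℝ] ℝ := ((I μ).coprod ((I ν).coprod (LinearMap.toSpanSingleton ℝ ℝ D))).comp
    (LinearMap.fst ℝ _ _)
  let F : ((C(X, ℝ) × C(X, ℝ) × ℝ) × C(X × X, ℝ)) →ₗ.[ℝ] ℝ :=
    ⟨LinearMap.ker (LinearMap.snd ℝ (C(X, ℝ) × C(X, ℝ) × ℝ) C(X × X, ℝ)), F₀.comp (Submodule.subtype _)⟩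
  obtain ⟨G, hGF, hGs⟩ := riesz_extension s F (by
    rintro ⟨⟨⟨f, g, t⟩, k⟩, hk⟩ ⟨ht, h⟩
    have hk' : k = 0 := hk
    subst hk'
    have := integral_add_integral_add_nonneg hD ht (f := f) (g := g) (by simpa using h)
    change 0 ≤ ∫ x, f x ∂(μ : Measure X) + (∫ x, g x ∂(ν : Measure X) + t * D)
    linarith) (by
    rintro ⟨⟨f, g, t⟩, k⟩
    -- Riesz extension needs each vector to enter the cone after adding one of the subspace:
    -- constants dominate `f`, `g` and `k`, and `-t` cancels the distance term.
    refine ⟨⟨⟨⟨ContinuousMap.const X (‖f‖ + ‖k‖), ContinuousMap.const X ‖g‖, -t⟩, 0⟩, rfl⟩, ?_, ?_⟩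
    · exact (neg_add_cancel t).ge
    · intro x y
      have h1 := neg_le_of_abs_le (f.norm_coe_le_norm x)
      have h2 := neg_le_of_abs_le (g.norm_coe_le_norm y)
      have h3 := neg_le_of_abs_le (k.norm_coe_le_norm (x, y))
      change 0 ≤ ((‖f‖ + ‖k‖) + f x) + (‖g‖ + g y) + (-t + t) * dist x y + (0 + k (x, y))
      rw [neg_add_cancel, zero_mul]
      linarith)
  have hG0 : ∀ f g t, G ((f, g, t), 0) = I μ f + (I ν g + t * D) := fun f g t =>
    hGF ⟨((f, g, t), 0), rfl⟩
  let Λ₀ : C(X × X, ℝ) →ₗ[ℝ] ℝ := G.comp (LinearMap.inr ℝ _ _)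
  have hΛ0 : ∀ k : C(X × X, ℝ), (∀ x, 0 ≤ k x) → 0 ≤ Λ₀ k := fun k hk =>
    hGs _ ⟨le_rfl, fun x y => by
      change 0 ≤ (0 : ℝ) + 0 + 0 * dist x y + k (x, y)
      simpa using hk (x, y)⟩
  have hsplit : ∀ f g t k, G ((f, g, t), k) = I μ f + (I ν g + t * D) + Λ₀ k := fun f g t k => by
    rw [← hG0, show (((f, g, t), k) : ((C(X, ℝ) × C(X, ℝ) × ℝ) × C(X × X, ℝ))) = ((f, g, t), 0) + (0, k) by simp, map_add]
    rfl
  have hΛ1 : ∀ f, Λ₀ (P₁ f) = I μ f := fun f => by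
    -- This vector and its negative both lie in the cone, so `G` vanishes on it; this is the
    -- marginal condition.
    have h1 := hGs ((-f, 0, 0), P₁ f) ⟨le_rfl, fun x y => by simp [P₁]⟩
    have h2 := hGs ((f, 0, 0), -P₁ f) ⟨le_rfl, fun x y => by simp [P₁]⟩
    rw [hsplit] at h1 h2
    simp only [map_neg, map_zero] at h1 h2
    linarith
  have hΛ2 : ∀ f, Λ₀ (P₂ f) = I ν f := fun f => by
    have h1 := hGs ((0, -f, 0), P₂ f) ⟨le_rfl, fun x y => by simp [P₂]⟩
    have h2 := hGs ((0, f, 0), -P₂ f) ⟨le_rfl, fun x y => by simp [P₂]⟩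
    rw [hsplit] at h1 h2
    simp only [map_neg, map_zero] at h1 h2
    linarith
  have hΛc : Λ₀ c ≤ D := by
    -- Here the sum defining the cone is `d - d = 0`, and positivity of `G` reads `D - Λ₀ c ≥ 0`.
    have h1 := hGs ((0, 0, 1), -c) ⟨zero_le_one, fun x y => by simp [c]⟩
    rw [hsplit] at h1
    simp only [map_neg, map_zero] at h1
    linarith
  let Λ : C_c(X × X, ℝ) →ₚ[ℝ] ℝ := PositiveLinearMap.mk₀
    { toFun := fun k => Λ₀ k.toContinuousMap
      map_add' := fun a b => map_add Λ₀ a.toContinuousMap b.toContinuousMap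
      map_smul' := fun r a => map_smul Λ₀ r a.toContinuousMap }
    fun k hk => hΛ0 _ fun x => hk x
  let γ := RealRMK.rieszMeasure Λ
  have hγ : ∀ k : C(X × X, ℝ), ∫ q, k q ∂γ = Λ₀ k := fun k =>
    RealRMK.integral_rieszMeasure Λ (CompactlySupportedContinuousMap.continuousMapEquiv k)
  have hfin : IsFiniteMeasure γ := by
    have : IsFiniteMeasureOnCompacts γ := inferInstanceAs
      (IsFiniteMeasureOnCompacts (rieszContent _).measure)
    exact CompactSpace.isFiniteMeasure
  have hfst : γ.fst = μ := by
    refine ext_of_forall_integral_eq_of_IsFiniteMeasure fun f => ?_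
    rw [Measure.fst, integral_map measurable_fst.aemeasurable
      f.continuous.aestronglyMeasurable]
    exact (hγ (P₁ f.toContinuousMap)).trans (hΛ1 _)
  have hsnd : γ.snd = ν := by
    refine ext_of_forall_integral_eq_of_IsFiniteMeasure fun f => ?_
    rw [Measure.snd, integral_map measurable_snd.aemeasurable
      f.continuous.aestronglyMeasurable]
    exact (hγ (P₂ f.toContinuousMap)).trans (hΛ2 _)
  have hprob : IsProbabilityMeasure γ := ⟨by
    rw [← Measure.fst_univ, hfst, measure_univ]⟩
  refine (iInf₂_le_of_le ⟨γ, hprob⟩ hfst (iInf_le _ hsnd)).trans ?_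
  have hc : Integrable c γ :=
    c.continuous.integrable_of_hasCompactSupport (HasCompactSupport.of_compactSpace _)
  have : ∫⁻ q, edist q.1 q.2 ∂γ = ENNReal.ofReal (∫ q, c q ∂γ) := by
    rw [ofReal_integral_eq_lintegral_ofReal hc (ae_of_all _ fun q => dist_nonneg)]
    exact lintegral_congr fun q => edist_dist _ _
  change ∫⁻ q, edist q.1 q.2 ∂γ ≤ _
  rw [this, hγ]
  exact ENNReal.ofReal_le_ofReal hΛc

/-- The easy inequality of Kantorovich–Rubinstein duality. -/
theorem ofReal_integral_sub_le_wasserstein1 {X : Type*} [MetricSpace X]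
    [MeasurableSpace X] {μ ν : ProbabilityMeasure X}
    {q : X → ℝ} (hq : ∀ x y, q x - q y ≤ dist x y) (hqm : Measurable q)
    (hμ : Integrable q (μ : Measure X)) (hν : Integrable q (ν : Measure X)) :
    ENNReal.ofReal (∫ x, q x ∂(μ : Measure X) - ∫ x, q x ∂(ν : Measure X))
      ≤ wasserstein1 μ ν := by
  refine le_iInf fun γ => le_iInf fun h1 => le_iInf fun h2 => ?_
  have h1' : MeasurePreserving Prod.fst (γ : Measure (X × X)) μ := ⟨measurable_fst, h1⟩
  have h2' : MeasurePreserving Prod.snd (γ : Measure (X × X)) ν := ⟨measurable_snd, h2⟩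
  have e1 : ∫ x, q x ∂(μ : Measure X) = ∫ z, q z.1 ∂(γ : Measure (X × X)) := by
    rw [← h1'.map_eq, integral_map measurable_fst.aemeasurable hqm.aestronglyMeasurable]
  have e2 : ∫ x, q x ∂(ν : Measure X) = ∫ z, q z.2 ∂(γ : Measure (X × X)) := by
    rw [← h2'.map_eq, integral_map measurable_snd.aemeasurable hqm.aestronglyMeasurable]
  have i1 : Integrable (fun z : X × X => q z.1) (γ : Measure (X × X)) :=
    h1'.integrable_comp_of_integrable hμ
  have i2 : Integrable (fun z : X × X => q z.2) (γ : Measure (X × X)) :=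
    h2'.integrable_comp_of_integrable hν
  rw [e1, e2, ← integral_sub i1 i2]
  -- The integral is at most that of the positive part, which is compared pointwise with `edist`;
  -- the cost of `γ` need not be known to be finite.
  refine (ENNReal.ofReal_le_of_le_toReal ?_).trans (lintegral_mono
    (f := fun z : X × X => ENNReal.ofReal (q z.1 - q z.2)) fun z => ?_)
  · rw [integral_eq_lintegral_pos_part_sub_lintegral_neg_part
      (f := fun z : X × X => q z.1 - q z.2) (i1.sub i2)]
    exact sub_le_self _ ENNReal.toReal_nonneg
  rw [edist_dist]
  exact ENNReal.ofReal_le_ofReal (hq _ _)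

/-! ### Comparison of Hausdorff measures and the area formula -/

/-- If `f` expands distances by at most the factor `K` compared with `L`, then so do the
Hausdorff measures of images. -/
theorem euclideanHausdorffMeasure_image_le_of_edist_le {X Y Z : Type*} [MetricSpace Y]
    [MeasurableSpace Y] [BorelSpace Y] [MetricSpace Z] [MeasurableSpace Z] [BorelSpace Z]
    {f : X → Y} {L : X → Z} {K : ℝ≥0} {A : Set X}
    (h : ∀ x ∈ A, ∀ y ∈ A, edist (f x) (f y) ≤ K * edist (L x) (L y)) (n : ℕ) :
    μHE[n] (f '' A) ≤ (K : ℝ≥0∞) ^ n * μHE[n] (L '' A) := by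
  rcases A.eq_empty_or_nonempty with rfl | ⟨a, ha⟩
  · simp
  have : Nonempty X := ⟨a⟩
  -- A section of `L` over `L '' A`. Points of `A` with equal `L` have equal `f` by hypothesis, so
  -- `f ∘ k` still covers `f '' A`, and it is `K`-Lipschitz.
  set k : Z → X := Function.invFunOn L A
  have hk : ∀ z ∈ L '' A, k z ∈ A ∧ L (k z) = z := fun z hz => Function.invFunOn_pos hz
  have hl : LipschitzOnWith K (f ∘ k) (L '' A) := by
    intro z hz w hw
    have := h _ (hk z hz).1 _ (hk w hw).1
    rwa [(hk z hz).2, (hk w hw).2] at this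
  have him : (f ∘ k) '' (L '' A) = f '' A := by
    rw [image_image]
    refine image_congr fun x hx => ?_
    have h1 := hk (L x) (mem_image_of_mem L hx)
    have := h _ h1.1 x hx
    rw [h1.2, edist_self, mul_zero] at this
    exact edist_le_zero.1 this
  have := hl.hausdorffMeasure_image_le (d := n) n.cast_nonneg
  rw [him, ENNReal.rpow_natCast] at this
  simp only [Measure.euclideanHausdorffMeasure_def, Measure.smul_apply, ENNReal.smul_def, smul_eq_mul]
  rw [mul_left_comm]
  gcongr

theorem HasStrictFDerivAt.exists_nhds_dist_le {U V : Type*} [NormedAddCommGroup U]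
    [NormedSpace ℝ U] [NormedAddCommGroup V] [NormedSpace ℝ V]
    {f : U → V} {f' : U →L[ℝ] V} {x : U} (hf : HasStrictFDerivAt f f' x) {C : ℝ} (hC0 : 0 < C)
    (hC : ∀ v, ‖v‖ ≤ C * ‖f' v‖) {K : ℝ} (hK : 1 < K) :
    ∃ s ∈ 𝓝 x, ∀ y ∈ s, ∀ z ∈ s,
      dist (f y) (f z) ≤ K * dist (f' y) (f' z) ∧ dist (f' y) (f' z) ≤ K * dist (f y) (f z) := by
  have hK0 : 0 < K := zero_lt_one.trans hK
  -- Chosen so that a relative error `ε` serves both directions: `1 / (1 - ε) = K` and `1 + ε ≤ K`.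
  -- Approximation with constant `ε / C` turns into relative error `ε` because `‖v‖ ≤ C ‖f' v‖`.
  set ε : ℝ := 1 - 1 / K
  have hε : 0 < ε := by
    simp only [ε]
    rw [sub_pos, div_lt_one hK0]
    exact hK
  have hc : 0 < ε / C := div_pos hε hC0
  obtain ⟨s, hs, hfs⟩ := hf.approximates_deriv_on_nhds (c := ⟨ε / C, hc.le⟩) (Or.inr hc)
  refine ⟨s, hs, fun y hy z hz => ?_⟩
  have h1 : ‖f y - f z - f' (y - z)‖ ≤ ε * ‖f' (y - z)‖ := by
    refine (hfs y hy z hz).trans ?_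
    have := mul_le_mul_of_nonneg_left (hC (y - z)) hc.le
    rwa [← mul_assoc, div_mul_cancel₀ _ hC0.ne'] at this
  rw [dist_eq_norm, dist_eq_norm, ← map_sub]
  have h2 : ‖f y - f z‖ ≤ ‖f y - f z - f' (y - z)‖ + ‖f' (y - z)‖ := by
    simpa using norm_add_le (f y - f z - f' (y - z)) (f' (y - z))
  have h3 : ‖f' (y - z)‖ ≤ ‖f y - f z - f' (y - z)‖ + ‖f y - f z‖ := by
    rw [norm_sub_rev (f y - f z)]
    simpa using norm_add_le (f' (y - z) - (f y - f z)) (f y - f z)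
  have h4 : ε ≤ K - 1 := by
    have : (K - 1) - ε = (K - 1) ^ 2 / K := by
      simp only [ε]
      field_simp
    have h5 : 0 ≤ (K - 1) ^ 2 / K := by positivity
    linarith
  constructor
  · have := mul_le_mul_of_nonneg_right h4 (norm_nonneg (f' (y - z)))
    linarith
  · have h5 : (1 / K) * ‖f' (y - z)‖ ≤ ‖f y - f z‖ := by
      have : 1 / K = 1 - ε := by simp [ε]
      rw [this]
      linarith
    rwa [one_div, inv_mul_le_iff₀ hK0] at h5

/-- Countably many of the neighbourhoods cover the space; made disjoint, they cut any measurable set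
into pieces on which the inequality is known. -/
theorem MeasureTheory.Measure.le_of_forall_exists_nhds {X : Type*} [TopologicalSpace X]
    [SecondCountableTopology X] [MeasurableSpace X] [OpensMeasurableSpace X] {μ ν : Measure X}
    (h : ∀ x, ∃ s ∈ 𝓝 x, ∀ A ⊆ s, MeasurableSet A → μ A ≤ ν A) : μ ≤ ν := by
  have h' : ∀ x, ∃ s, IsOpen s ∧ x ∈ s ∧ ∀ A ⊆ s, MeasurableSet A → μ A ≤ ν A := fun x => by
    obtain ⟨s, hs, h⟩ := h x
    exact ⟨interior s, isOpen_interior, mem_interior_iff_mem_nhds.2 hs,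
      fun A hA => h A (hA.trans interior_subset)⟩
  choose s hso hxs hs using h'
  obtain ⟨t, htc, ht⟩ := TopologicalSpace.countable_cover_nhds fun x => (hso x).mem_nhds (hxs x)
  refine Measure.le_iff.2 fun A hA => ?_
  rcases t.eq_empty_or_nonempty with rfl | hne
  · have : A = ∅ := by
      rw [biUnion_empty] at ht
      exact subset_eq_empty (ht ▸ subset_univ A) rfl
    simp [this]
  obtain ⟨e, rfl⟩ := htc.exists_eq_range hne
  set D : ℕ → Set X := disjointed fun n => s (e n)
  have hD : ⋃ n, D n = univ := by
    rw [iUnion_disjointed, ← ht, biUnion_range]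
  have hDm : ∀ n, MeasurableSet (D n) := MeasurableSet.disjointed fun n => (hso _).measurableSet
  have key : ∀ m : Measure X, m A = ∑' n, m (A ∩ D n) := fun m => by
    rw [← measure_iUnion _ fun n => hA.inter (hDm n), ← inter_iUnion, hD, inter_univ]
    intro i j hij
    exact ((disjoint_disjointed _) hij).mono inter_subset_right inter_subset_right
  rw [key μ, key ν]
  exact ENNReal.tsum_le_tsum fun n => hs (e n) _
    (inter_subset_right.trans (disjointed_subset _ n)) (hA.inter (hDm n))

section Area

variable {U V : Type*} [NormedAddCommGroup U] [InnerProductSpace ℝ U] [FiniteDimensional ℝ U]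
  [NormedAddCommGroup V] [InnerProductSpace ℝ V] [FiniteDimensional ℝ V]

theorem continuous_normDet_fderiv {f : U → V} (hf : ContDiff ℝ 1 f) :
    Continuous fun x => (fderiv ℝ f x : U →ₗ[ℝ] V).normDet := by
  have h1 : ∀ x, (fderiv ℝ f x : U →ₗ[ℝ] V).normDet
      = Real.sqrt ((ContinuousLinearMap.adjoint (fderiv ℝ f x) ∘L fderiv ℝ f x).det) := fun x => by
    rw [← ContinuousLinearMap.normDet_sq]
    exact (Real.sqrt_sq (LinearMap.normDet_nonneg _)).symm
  simp only [h1]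
  have h2 : Continuous (fderiv ℝ f) := hf.continuous_fderiv (by norm_num)
  have h3 : Continuous fun x => ContinuousLinearMap.adjoint (fderiv ℝ f x) :=
    (ContinuousLinearMap.adjoint (𝕜 := ℝ) (E := U) (F := V)).continuous.comp h2
  exact (ContinuousLinearMap.continuous_det.comp (h3.clm_comp h2)).sqrt

variable [MeasurableSpace U] [BorelSpace U] [MeasurableSpace V] [BorelSpace V]

/-- The **area formula** for an injective `C¹` immersion. -/
theorem euclideanHausdorffMeasure_image_eq_lintegral_normDet {f : U → V} (hf : ContDiff ℝ 1 f)
    (hinj : Function.Injective f) (hf' : ∀ x, Function.Injective (fderiv ℝ f x))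
    {A : Set U} (hA : MeasurableSet A) :
    μHE[finrank ℝ U] (f '' A)
      = ∫⁻ x in A, ENNReal.ofReal (fderiv ℝ f x : U →ₗ[ℝ] V).normDet := by
  set n := finrank ℝ U
  set J : U → ℝ := fun x => (fderiv ℝ f x : U →ₗ[ℝ] V).normDet with hJ
  have hJc : Continuous J := continuous_normDet_fderiv hf
  have hJpos : ∀ x, 0 < J x := fun x => by
    refine lt_of_le_of_ne (LinearMap.normDet_nonneg _) (Ne.symm ?_)
    exact ((fderiv ℝ f x : U →ₗ[ℝ] V).normDet_ne_zero_tfae.out 0 4).2 (hf' x)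
  have hemb : MeasurableEmbedding f := hf.continuous.measurableEmbedding hinj
  set m₁ : Measure U := volume.withDensity fun x => ENNReal.ofReal (J x) with hm₁
  set m₂ : Measure U := (μHE[n] : Measure V).comap f with hm₂
  have hm₂A : ∀ B, m₂ B = μHE[n] (f '' B) := fun B => hemb.comap_apply _ _
  -- Near each point `f` is `K`-bi-Lipschitz relative to its derivative, which costs `K ^ n` in
  -- Hausdorff measure; the variation of the Jacobian costs one more factor `K`. For the linear map
  -- itself the formula is known. Letting `K` tend to 1 gives equality.
  have key : ∀ K : ℝ≥0, 1 < K →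
      m₂ ≤ (K ^ (n + 1)) • m₁ ∧ m₁ ≤ (K ^ (n + 1)) • m₂ := by
    intro K hK
    have hloc : ∀ x, ∃ s ∈ 𝓝 x, ∀ B ⊆ s, MeasurableSet B →
        m₂ B ≤ ((K ^ (n + 1)) • m₁) B ∧ m₁ B ≤ ((K ^ (n + 1)) • m₂) B := by
      intro x
      obtain ⟨C, hC0, hC⟩ := ((fderiv ℝ f x : U →ₗ[ℝ] V).injective_iff_antilipschitz).1 (hf' x)
      obtain ⟨s, hs, hd⟩ := (hf.contDiffAt.hasStrictFDerivAt (by norm_num)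
        ).exists_nhds_dist_le (C := C) (x := x) hC0 (fun v => by simpa using hC.le_mul_dist v 0)
        (K := K) (by exact_mod_cast hK)
      have hKJ : J x < K * J x := lt_mul_of_one_lt_left (hJpos x) (by exact_mod_cast hK)
      have hJ1 : ∀ᶠ y in 𝓝 x, J y < K * J x :=
        hJc.continuousAt.eventually_lt continuousAt_const hKJ
      have hJ2 : ∀ᶠ y in 𝓝 x, J x < K * J y :=
        continuousAt_const.eventually_lt (continuousAt_const.mul hJc.continuousAt) hKJ
      refine ⟨_, inter_mem hs (hJ1.and hJ2), fun B hB hBm => ?_⟩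
      have hlin : μHE[n] (fderiv ℝ f x '' B) = ENNReal.ofReal (J x) * volume B :=
        LinearMap.euclideanHausdorffMeasure_image_eq_normDet_mul_volume _ _
      have hm₁B : m₁ B = ∫⁻ y in B, ENNReal.ofReal (J y) := withDensity_apply _ hBm
      constructor
      · have h1 : m₂ B ≤ (K : ℝ≥0∞) ^ n * (ENNReal.ofReal (J x) * volume B) := by
          rw [hm₂A, ← hlin]
          refine euclideanHausdorffMeasure_image_le_of_edist_le (fun y hy z hz => ?_) n
          rw [edist_dist, edist_dist, ← ENNReal.ofReal_coe_nnreal,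
            ← ENNReal.ofReal_mul K.coe_nonneg]
          exact ENNReal.ofReal_le_ofReal (hd y (hB hy).1 z (hB hz).1).1
        have h2 : ENNReal.ofReal (J x) * volume B ≤ K * m₁ B := by
          rw [hm₁B, ← setLIntegral_const, ← lintegral_const_mul' _ _ ENNReal.coe_ne_top]
          refine setLIntegral_mono' hBm fun y hy => ?_
          rw [← ENNReal.ofReal_coe_nnreal, ← ENNReal.ofReal_mul K.coe_nonneg]
          exact ENNReal.ofReal_le_ofReal (hB hy).2.2.le
        refine h1.trans ?_
        rw [Measure.smul_apply, ENNReal.smul_def, smul_eq_mul, ENNReal.coe_pow, pow_succ, mul_assoc]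
        gcongr
      · have h1 : ENNReal.ofReal (J x) * volume B ≤ (K : ℝ≥0∞) ^ n * m₂ B := by
          rw [hm₂A, ← hlin]
          refine euclideanHausdorffMeasure_image_le_of_edist_le (fun y hy z hz => ?_) n
          rw [edist_dist, edist_dist, ← ENNReal.ofReal_coe_nnreal,
            ← ENNReal.ofReal_mul K.coe_nonneg]
          exact ENNReal.ofReal_le_ofReal (hd y (hB hy).1 z (hB hz).1).2
        have h2 : m₁ B ≤ K * (ENNReal.ofReal (J x) * volume B) := by
          rw [hm₁B, ← setLIntegral_const, ← lintegral_const_mul' _ _ ENNReal.coe_ne_top]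
          refine setLIntegral_mono' hBm fun y hy => ?_
          rw [← ENNReal.ofReal_coe_nnreal, ← ENNReal.ofReal_mul K.coe_nonneg]
          exact ENNReal.ofReal_le_ofReal (hB hy).2.1.le
        refine h2.trans ?_
        rw [Measure.smul_apply, ENNReal.smul_def, smul_eq_mul, ENNReal.coe_pow, pow_succ', mul_assoc]
        gcongr
    exact ⟨Measure.le_of_forall_exists_nhds fun x => (hloc x).imp fun s hs =>
        ⟨hs.1, fun B hB hBm => (hs.2 B hB hBm).1⟩,
      Measure.le_of_forall_exists_nhds fun x => (hloc x).imp fun s hs =>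
        ⟨hs.1, fun B hB hBm => (hs.2 B hB hBm).2⟩⟩
  have hlim : ∀ a : ℝ≥0∞, Tendsto (fun K : ℝ≥0 => ((K ^ (n + 1) : ℝ≥0) : ℝ≥0∞) * a) (𝓝[>] 1) (𝓝 a) := by
    intro a
    have h1 : Tendsto (fun K : ℝ≥0 => ((K ^ (n + 1) : ℝ≥0) : ℝ≥0∞)) (𝓝[>] 1) (𝓝 1) := by
      have : Continuous fun K : ℝ≥0 => ((K ^ (n + 1) : ℝ≥0) : ℝ≥0∞) :=
        ENNReal.continuous_coe.comp (continuous_pow _)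
      simpa using (this.tendsto 1).mono_left nhdsWithin_le_nhds
    simpa using ENNReal.Tendsto.mul_const h1 (Or.inl one_ne_zero) (b := a)
  have : m₂ = m₁ := by
    refine le_antisymm (Measure.le_iff.2 fun B hB => ?_) (Measure.le_iff.2 fun B hB => ?_)
    · refine ge_of_tendsto (hlim (m₁ B)) ?_
      filter_upwards [self_mem_nhdsWithin] with K hK
      exact (key K hK).1 B
    · refine ge_of_tendsto (hlim (m₂ B)) ?_
      filter_upwards [self_mem_nhdsWithin] with K hK
      exact (key K hK).2 B
  rw [← hm₂A, this, hm₁, withDensity_apply _ hA]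

theorem map_withDensity_normDet {f : U → V} (hf : ContDiff ℝ 1 f)
    (hinj : Function.Injective f) (hf' : ∀ x, Function.Injective (fderiv ℝ f x)) :
    (volume.withDensity fun x => ENNReal.ofReal (fderiv ℝ f x : U →ₗ[ℝ] V).normDet).map f
      = μHE[finrank ℝ U].restrict (range f) := by
  ext B hB
  have hm := hf.continuous.measurable
  rw [Measure.map_apply hm hB, withDensity_apply _ (hm hB),
    ← euclideanHausdorffMeasure_image_eq_lintegral_normDet hf hinj hf' (hm hB),
    image_preimage_eq_inter_range, Measure.restrict_apply hB]

end Area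

/-! ### Geometry of graphs over a hyperplane -/

section Graph

variable {E : Type*} [NormedAddCommGroup E] [InnerProductSpace ℝ E] [FiniteDimensional ℝ E]

/-- The map `(y, s) ↦ y + (g y + s) e`, which straightens the region below the graph of `g`. -/
def graphShear (e : E) (g : (ℝ ∙ e)ᗮ → ℝ) (p : (ℝ ∙ e)ᗮ × ℝ) : E := (p.1 : E) + (g p.1 + p.2) • e

/-- The parametrisation `y ↦ y + g y e` of the graph of `g`. -/
def graphMap (e : E) (g : (ℝ ∙ e)ᗮ → ℝ) (y : (ℝ ∙ e)ᗮ) : E := (y : E) + g y • e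

/-- The upper normal `e - ∇ g y` (not normalised) of the graph of `g`. -/
def graphNormal (e : E) (g : (ℝ ∙ e)ᗮ → ℝ) (y : (ℝ ∙ e)ᗮ) : E := e - (gradient g y : (ℝ ∙ e)ᗮ)

theorem inner_coe_orthogonal_span_singleton (e : E) (y : (ℝ ∙ e)ᗮ) : ⟪e, (y : E)⟫_ℝ = 0 :=
  Submodule.mem_orthogonal_singleton_iff_inner_right.1 y.2

theorem orthogonalProjectionOnto_add_smul (e : E) (y : (ℝ ∙ e)ᗮ) (t : ℝ) :
    (ℝ ∙ e)ᗮ.orthogonalProjectionOnto ((y : E) + t • e) = y := by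
  have h : (ℝ ∙ e)ᗮ.orthogonalProjectionOnto e = 0 := by
    rw [Submodule.orthogonalProjectionOnto_eq_zero_iff, Submodule.orthogonal_orthogonal]
    exact Submodule.mem_span_singleton_self e
  rw [map_add, map_smul, h, smul_zero, add_zero, Submodule.orthogonalProjectionOnto_mem_subspace_eq_self]

theorem inner_add_smul_self {e : E} (he : ‖e‖ = 1) (y : (ℝ ∙ e)ᗮ) (t : ℝ) :
    ⟪e, (y : E) + t • e⟫_ℝ = t := by
  rw [inner_add_right, inner_coe_orthogonal_span_singleton, inner_smul_right,
    real_inner_self_eq_norm_sq, he]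
  simp

theorem orthogonalProjectionOnto_add_inner_smul {e : E} (he : ‖e‖ = 1) (x : E) :
    ((ℝ ∙ e)ᗮ.orthogonalProjectionOnto x : E) + ⟪e, x⟫_ℝ • e = x := by
  have h := Submodule.starProjection_add_starProjection_orthogonal (K := ℝ ∙ e) x
  rw [Submodule.starProjection_unit_singleton ℝ he] at h
  rw [add_comm]
  exact h

/-- Orthogonal coordinates on `E` with respect to a unit vector. -/
def orthogonalCoordinates {e : E} (he : ‖e‖ = 1) : WithLp 2 ((ℝ ∙ e)ᗮ × ℝ) ≃ₗᵢ[ℝ] E :=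
  LinearIsometryEquiv.ofSurjective
    { toFun := fun p => (p.fst : E) + p.snd • e
      map_add' := fun p q => by
        simp only [WithLp.add_fst, WithLp.add_snd, Submodule.coe_add, add_smul]
        abel
      map_smul' := fun c p => by
        simp [mul_smul]
      norm_map' := fun p => by
        rw [← sq_eq_sq₀ (norm_nonneg _) (norm_nonneg _), WithLp.prod_norm_sq_eq_of_L2]
        change ‖(p.fst : E) + p.snd • e‖ ^ 2 = _
        rw [norm_add_sq_real, inner_smul_right, real_inner_comm,
          inner_coe_orthogonal_span_singleton, norm_smul, he]
        simp }
    fun x => ⟨WithLp.toLp 2 ((ℝ ∙ e)ᗮ.orthogonalProjectionOnto x, ⟪e, x⟫_ℝ),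
      orthogonalProjectionOnto_add_inner_smul he x⟩

theorem contDiff_graphShear {e : E} {g : (ℝ ∙ e)ᗮ → ℝ} (hg : ContDiff ℝ 1 g) :
    ContDiff ℝ 1 (graphShear e g) := by
  unfold graphShear
  have : ContDiff ℝ 1 fun y : (ℝ ∙ e)ᗮ => (y : E) := (ℝ ∙ e)ᗮ.subtypeL.contDiff
  fun_prop

/-- `graphShear` as a homeomorphism. -/
def graphShearHomeomorph {e : E} (he : ‖e‖ = 1) {g : (ℝ ∙ e)ᗮ → ℝ} (hg : Continuous g) :
    (ℝ ∙ e)ᗮ × ℝ ≃ₜ E where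
  toFun := graphShear e g
  invFun x := ((ℝ ∙ e)ᗮ.orthogonalProjectionOnto x,
    ⟪e, x⟫_ℝ - g ((ℝ ∙ e)ᗮ.orthogonalProjectionOnto x))
  left_inv p := by
    simp only [graphShear]
    rw [orthogonalProjectionOnto_add_smul, inner_add_smul_self he]
    simp
  right_inv x := by
    simp only [graphShear]
    rw [add_sub_cancel, orthogonalProjectionOnto_add_inner_smul he]
  continuous_toFun := by
    unfold graphShear
    fun_prop
  continuous_invFun := by fun_prop

theorem hasFDerivAt_graphMap {e : E} {g : (ℝ ∙ e)ᗮ → ℝ} (hg : ContDiff ℝ 1 g) (y : (ℝ ∙ e)ᗮ) :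
    HasFDerivAt (graphMap e g) ((ℝ ∙ e)ᗮ.subtypeL + (fderiv ℝ g y).smulRight e) y :=
  (ℝ ∙ e)ᗮ.subtypeL.hasFDerivAt.add
    ((hg.differentiable one_ne_zero y).hasFDerivAt.smul_const e)

theorem contDiff_graphMap {e : E} {g : (ℝ ∙ e)ᗮ → ℝ} (hg : ContDiff ℝ 1 g) :
    ContDiff ℝ 1 (graphMap e g) := by
  unfold graphMap
  have : ContDiff ℝ 1 fun y : (ℝ ∙ e)ᗮ => (y : E) := (ℝ ∙ e)ᗮ.subtypeL.contDiff
  fun_prop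

theorem inner_graphNormal {e : E} {g : (ℝ ∙ e)ᗮ → ℝ} (y : (ℝ ∙ e)ᗮ) (v : E) :
    ⟪graphNormal e g y, v⟫_ℝ
      = ⟪e, v⟫_ℝ - fderiv ℝ g y ((ℝ ∙ e)ᗮ.orthogonalProjectionOnto v) := by
  rw [graphNormal, inner_sub_left, ← inner_gradient_left,
    Submodule.inner_orthogonalProjectionOnto_eq_of_mem_left]

theorem norm_sq_graphNormal {e : E} (he : ‖e‖ = 1) {g : (ℝ ∙ e)ᗮ → ℝ} (y : (ℝ ∙ e)ᗮ) :
    ‖graphNormal e g y‖ ^ 2 = 1 + ‖gradient g y‖ ^ 2 := by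
  rw [graphNormal, norm_sub_sq_real, inner_coe_orthogonal_span_singleton, he]
  simp

theorem graphNormal_ne_zero {e : E} (he : ‖e‖ = 1) {g : (ℝ ∙ e)ᗮ → ℝ} (y : (ℝ ∙ e)ᗮ) :
    graphNormal e g y ≠ 0 := by
  intro h
  have := norm_sq_graphNormal he (g := g) y
  rw [h, norm_zero] at this
  nlinarith [sq_nonneg ‖gradient g y‖]

theorem continuous_graphNormal {e : E} {g : (ℝ ∙ e)ᗮ → ℝ} (hg : ContDiff ℝ 1 g) :
    Continuous (graphNormal e g) := by
  have : Continuous (gradient g) :=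
    (InnerProductSpace.toDual ℝ _).symm.continuous.comp (hg.continuous_fderiv one_ne_zero)
  exact continuous_const.sub (continuous_subtype_val.comp this)

theorem orthogonalProjectionOnto_graphMap (e : E) (g : (ℝ ∙ e)ᗮ → ℝ) (y : (ℝ ∙ e)ᗮ) :
    (ℝ ∙ e)ᗮ.orthogonalProjectionOnto (graphMap e g y) = y :=
  orthogonalProjectionOnto_add_smul e y _

theorem injective_graphMap (e : E) (g : (ℝ ∙ e)ᗮ → ℝ) : Function.Injective (graphMap e g) :=
  Function.LeftInverse.injective (orthogonalProjectionOnto_graphMap e g)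

theorem range_graphMap {e : E} (he : ‖e‖ = 1) (g : (ℝ ∙ e)ᗮ → ℝ) :
    range (graphMap e g) = {x | ⟪e, x⟫_ℝ = g ((ℝ ∙ e)ᗮ.orthogonalProjectionOnto x)} := by
  ext x
  constructor
  · rintro ⟨y, rfl⟩
    rw [mem_ofPred_eq, orthogonalProjectionOnto_graphMap, graphMap, inner_add_smul_self he]
  · intro h
    refine ⟨(ℝ ∙ e)ᗮ.orthogonalProjectionOnto x, ?_⟩
    rw [graphMap, ← h, orthogonalProjectionOnto_add_inner_smul he]

theorem injective_fderiv_graphMap {e : E} {g : (ℝ ∙ e)ᗮ → ℝ} (hg : ContDiff ℝ 1 g)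
    (y : (ℝ ∙ e)ᗮ) : Function.Injective (fderiv ℝ (graphMap e g) y) := by
  rw [(hasFDerivAt_graphMap hg y).fderiv]
  refine Function.LeftInverse.injective (g := (ℝ ∙ e)ᗮ.orthogonalProjectionOnto) fun w => ?_
  exact orthogonalProjectionOnto_add_smul e w _

/-- The Gram operator of the derivative is `w ↦ w + dg(w) ∇g`, a rank-one perturbation of the
identity with determinant `1 + |∇g|²`, and this is `|e - ∇g|²` by Pythagoras. -/
theorem normDet_fderiv_graphMap {e : E} (he : ‖e‖ = 1) {g : (ℝ ∙ e)ᗮ → ℝ} (hg : ContDiff ℝ 1 g)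
    (y : (ℝ ∙ e)ᗮ) :
    (fderiv ℝ (graphMap e g) y : (ℝ ∙ e)ᗮ →ₗ[ℝ] E).normDet = ‖graphNormal e g y‖ := by
  rw [← sq_eq_sq₀ (LinearMap.normDet_nonneg _) (norm_nonneg _), norm_sq_graphNormal he]
  have h := (fderiv ℝ (graphMap e g) y : (ℝ ∙ e)ᗮ →ₗ[ℝ] E).normDet_sq
  have h2 : (fderiv ℝ (graphMap e g) y : (ℝ ∙ e)ᗮ →ₗ[ℝ] E).adjoint
      ∘ₗ (fderiv ℝ (graphMap e g) y : (ℝ ∙ e)ᗮ →ₗ[ℝ] E)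
      = LinearMap.transvection (fderiv ℝ g y : (ℝ ∙ e)ᗮ →ₗ[ℝ] ℝ) (gradient g y) := by
    ext1 w
    refine ext_inner_right ℝ fun w' => ?_
    rw [LinearMap.comp_apply, LinearMap.adjoint_inner_left, (hasFDerivAt_graphMap hg y).fderiv,
      LinearMap.transvection.apply, inner_add_left, inner_smul_left, inner_gradient_left]
    change ⟪(w : E) + fderiv ℝ g y w • e, (w' : E) + fderiv ℝ g y w' • e⟫_ℝ = _
    rw [inner_add_left, inner_add_right, inner_smul_left, inner_add_smul_self he,
      inner_smul_right, real_inner_comm e (w : E), inner_coe_orthogonal_span_singleton]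
    simp
  rw [h2, LinearMap.transvection.det] at h
  have h3 : fderiv ℝ g y (gradient g y) = ‖gradient g y‖ ^ 2 := by
    rw [← inner_gradient_left, real_inner_self_eq_norm_sq]
  rw [← h3]
  exact h

variable [MeasurableSpace E] [BorelSpace E]

/-- A translation of each vertical fibre followed by an isometry. -/
theorem measurePreserving_graphShear {e : E} (he : ‖e‖ = 1) {g : (ℝ ∙ e)ᗮ → ℝ}
    (hg : Continuous g) : MeasurePreserving (graphShear e g) := by
  have h1 : MeasurePreserving (fun p : (ℝ ∙ e)ᗮ × ℝ => (p.1, g p.1 + p.2)) := by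
    refine (MeasurePreserving.id _).skew_product (g := fun y s => g y + s) ?_ ?_
    · exact ((hg.measurable.comp measurable_fst).add measurable_snd)
    · exact ae_of_all _ fun y => map_add_left_eq_self volume (g y)
  exact ((orthogonalCoordinates he).measurePreserving.comp
    (WithLp.volume_preserving_toLp _ _)).comp h1

theorem measurableEmbedding_graphShear {e : E} (he : ‖e‖ = 1) {g : (ℝ ∙ e)ᗮ → ℝ}
    (hg : Continuous g) : MeasurableEmbedding (graphShear e g) :=
  (graphShearHomeomorph he hg).measurableEmbedding

theorem volume_range_graphMap {e : E} (he : ‖e‖ = 1) {g : (ℝ ∙ e)ᗮ → ℝ} (hg : Continuous g) :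
    volume (range (graphMap e g)) = 0 := by
  rw [← (measurePreserving_graphShear he hg).measure_preimage_emb
    (measurableEmbedding_graphShear he hg)]
  have : graphShear e g ⁻¹' range (graphMap e g) = univ ×ˢ {0} := by
    ext p
    rw [range_graphMap he, mem_preimage, mem_ofPred_eq, graphShear, inner_add_smul_self he,
      orthogonalProjectionOnto_add_smul]
    simp
  rw [this, Measure.volume_eq_prod, Measure.prod_prod]
  simp

theorem map_withDensity_graphNormal {e : E} (he : ‖e‖ = 1) {g : (ℝ ∙ e)ᗮ → ℝ}
    (hg : ContDiff ℝ 1 g) :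
    (volume.withDensity fun y => ENNReal.ofReal ‖graphNormal e g y‖).map (graphMap e g)
      = μHE[finrank ℝ E - 1].restrict (range (graphMap e g)) := by
  have hd : finrank ℝ (ℝ ∙ e)ᗮ = finrank ℝ E - 1 := by
    have h := Submodule.finrank_add_finrank_orthogonal (ℝ ∙ e)
    rw [finrank_span_singleton (by rintro rfl; simp at he)] at h
    omega
  rw [← hd, ← map_withDensity_normDet (contDiff_graphMap hg) (injective_graphMap e g)
    (injective_fderiv_graphMap hg)]
  simp only [normDet_fderiv_graphMap he hg]

/-- The area density is the length of the unnormalised normal, so it cancels the normalisation. -/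
theorem integral_inner_graphNormal {e : E} (he : ‖e‖ = 1) {g : (ℝ ∙ e)ᗮ → ℝ}
    (hg : ContDiff ℝ 1 g) (f : E → ℝ) (v : E) :
    ∫ y, f (graphMap e g y) * ⟪graphNormal e g y, v⟫_ℝ
      = ∫ x in range (graphMap e g), f x * ⟪‖graphNormal e g ((ℝ ∙ e)ᗮ.orthogonalProjectionOnto x)‖⁻¹
          • graphNormal e g ((ℝ ∙ e)ᗮ.orthogonalProjectionOnto x), v⟫_ℝ ∂μHE[finrank ℝ E - 1] := by
  have hN := continuous_graphNormal hg
  rw [← map_withDensity_graphNormal he hg,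
    ((contDiff_graphMap hg).continuous.measurableEmbedding (injective_graphMap e g)).integral_map,
    integral_withDensity_eq_integral_toReal_smul hN.norm.measurable.ennreal_ofReal
      (ae_of_all _ fun _ => ENNReal.ofReal_lt_top)]
  refine integral_congr_ae (ae_of_all _ fun y => ?_)
  have h := norm_ne_zero_iff.2 (graphNormal_ne_zero he (g := g) y)
  simp only [orthogonalProjectionOnto_graphMap, ENNReal.toReal_ofReal (norm_nonneg _),
    smul_eq_mul, inner_smul_left]
  simp
  field_simp

end Graph

/-! ### The divergence theorem below a graph -/

theorem integral_fderiv_eq_zero_of_hasCompactSupport {E : Type*} [NormedAddCommGroup E]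
    [NormedSpace ℝ E] [FiniteDimensional ℝ E] [MeasurableSpace E] [BorelSpace E]
    (μ : Measure E) [μ.IsAddHaarMeasure] {f : E → ℝ} (hf : ContDiff ℝ 1 f)
    (hfs : HasCompactSupport f) (v : E) : ∫ x, fderiv ℝ f x v ∂μ = 0 := by
  have h1 : Integrable (fun x => fderiv ℝ f x v) μ :=
    ((hf.continuous_fderiv one_ne_zero).clm_apply continuous_const).integrable_of_hasCompactSupport
      (hfs.fderiv_apply ℝ v)
  have h := integral_mul_fderiv_eq_neg_fderiv_mul_of_integrable (μ := μ) (f := fun _ : E => (1 : ℝ))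
    (g := f) (v := v) (by simp) (by simpa using h1)
    (by simpa using hf.continuous.integrable_of_hasCompactSupport hfs) (by simp)
    (fun x _ => hf.differentiable one_ne_zero x)
  simpa using h

section Graph

variable {E : Type*} [NormedAddCommGroup E] [InnerProductSpace ℝ E] [FiniteDimensional ℝ E]
  [MeasurableSpace E] [BorelSpace E]

/-- The flat case. The tangential part integrates to zero over each slice; the normal part is
integrated along each vertical line by the fundamental theorem of calculus. Since `τ` does not
depend on the vertical variable, no derivative falls on it and continuity suffices; this matters
because the normal of a `C¹` graph is merely continuous. -/
theorem integral_Iic_fderiv_prod {W : Type*} [NormedAddCommGroup W] [InnerProductSpace ℝ W]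
    [FiniteDimensional ℝ W] [MeasurableSpace W] [BorelSpace W] {F : W × ℝ → ℝ}
    (hF : ContDiff ℝ 1 F) (hFs : HasCompactSupport F) (w : W) {τ : W → ℝ} (hτ : Continuous τ) :
    ∫ p in univ ×ˢ Iic (0 : ℝ), fderiv ℝ F p (w, τ p.1) = ∫ y, F (y, 0) * τ y := by
  have hd := hF.continuous_fderiv one_ne_zero
  have hdiff := hF.differentiable one_ne_zero
  set A : W × ℝ → ℝ := fun p => fderiv ℝ F p (w, 0) with hA
  set B : W × ℝ → ℝ := fun p => fderiv ℝ F p (0, 1) with hB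
  have hAc : Continuous A := hd.clm_apply continuous_const
  have hBc : Continuous B := hd.clm_apply continuous_const
  have hAi : Integrable A := hAc.integrable_of_hasCompactSupport (hFs.fderiv_apply ℝ _)
  have hBi : Integrable (fun p => τ p.1 * B p) :=
    ((hτ.comp continuous_fst).mul hBc).integrable_of_hasCompactSupport
      (hFs.fderiv_apply ℝ _).mul_left
  have hsplit : ∀ p : W × ℝ, fderiv ℝ F p (w, τ p.1) = A p + τ p.1 * B p := fun p => by
    have : ((w, τ p.1) : W × ℝ) = (w, 0) + τ p.1 • (0, 1) := by simp
    rw [this, map_add, map_smul, smul_eq_mul]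
  simp only [hsplit]
  rw [integral_add hAi.integrableOn hBi.integrableOn]
  have hW : ∀ s, HasCompactSupport fun y => F (y, s) := fun s => by
    refine HasCompactSupport.of_support_subset_isCompact (hFs.isCompact.image continuous_fst) ?_
    intro y hy
    exact ⟨(y, s), subset_tsupport F hy, rfl⟩
  have hR : ∀ y, HasCompactSupport fun s => F (y, s) := fun y => by
    refine HasCompactSupport.of_support_subset_isCompact (hFs.isCompact.image continuous_snd) ?_
    intro s hs
    exact ⟨(y, s), subset_tsupport F hs, rfl⟩
  have hvol : (volume : Measure (W × ℝ)).restrict (univ ×ˢ Iic (0 : ℝ))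
      = (volume : Measure W).prod ((volume : Measure ℝ).restrict (Iic 0)) := by
    rw [Measure.volume_eq_prod, ← Measure.prod_restrict, Measure.restrict_univ]
  have hA0 : ∫ p in univ ×ˢ Iic (0 : ℝ), A p = 0 := by
    have hAi' := hAi.integrableOn (s := univ ×ˢ Iic (0 : ℝ))
    rw [IntegrableOn, hvol] at hAi'
    rw [hvol, integral_prod_symm _ hAi']
    refine integral_eq_zero_of_ae (ae_of_all _ fun s => ?_)
    have h1 := integral_fderiv_eq_zero_of_hasCompactSupport volume
      (hF.comp (contDiff_prodMk_left s)) (hW s) w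
    rw [Pi.zero_apply, ← h1]
    refine integral_congr_ae (ae_of_all _ fun y => ?_)
    have h2 : HasFDerivAt (F ∘ fun y => (y, s)) (fderiv ℝ F (y, s) ∘L ContinuousLinearMap.inl ℝ W ℝ) y :=
      (hdiff (y, s)).hasFDerivAt.comp y (hasFDerivAt_prodMk_left y s)
    simp [h2.fderiv, hA]
  have hB0 : ∫ p in univ ×ˢ Iic (0 : ℝ), τ p.1 * B p = ∫ y, F (y, 0) * τ y := by
    have hBi' := hBi.integrableOn (s := univ ×ˢ Iic (0 : ℝ))
    rw [IntegrableOn, hvol] at hBi'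
    rw [hvol, integral_prod _ hBi']
    refine integral_congr_ae (ae_of_all _ fun y => ?_)
    have h1 := (hR y).integral_Iic_deriv_eq (hF.comp (contDiff_prodMk_right y)) 0
    change _ = F (y, 0) at h1
    dsimp only
    rw [integral_const_mul, mul_comm, ← h1]
    congr 2
    ext s
    have h2 : HasFDerivAt (F ∘ fun s => (y, s)) (fderiv ℝ F (y, s) ∘L ContinuousLinearMap.inr ℝ W ℝ) s :=
      (hdiff (y, s)).hasFDerivAt.comp s (hasFDerivAt_prodMk_right y s)
    exact h2.hasDerivAt.deriv.symm
  rw [hA0, hB0, zero_add]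

/-- The divergence theorem for the region below the graph of a `C¹` function. -/
theorem integral_fderiv_lt_graph {e : E} (he : ‖e‖ = 1) {g : (ℝ ∙ e)ᗮ → ℝ} (hg : ContDiff ℝ 1 g)
    {f : E → ℝ} (hf : ContDiff ℝ 1 f) (hfs : HasCompactSupport f) (v : E) :
    ∫ x in {x | ⟪e, x⟫_ℝ ≤ g ((ℝ ∙ e)ᗮ.orthogonalProjectionOnto x)}, fderiv ℝ f x v
      = ∫ y, f (graphMap e g y) * ⟪graphNormal e g y, v⟫_ℝ := by
  have hS := contDiff_graphShear hg
  have hF : ContDiff ℝ 1 (f ∘ graphShear e g) := hf.comp hS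
  have hFs : HasCompactSupport (f ∘ graphShear e g) :=
    hfs.comp_homeomorph (graphShearHomeomorph he hg.continuous)
  set w := (ℝ ∙ e)ᗮ.orthogonalProjectionOnto v
  have hτ : Continuous fun y => ⟪graphNormal e g y, v⟫_ℝ :=
    (continuous_graphNormal hg).inner continuous_const
  have h := integral_Iic_fderiv_prod hF hFs w hτ
  have hpre : graphShear e g ⁻¹' {x | ⟪e, x⟫_ℝ ≤ g ((ℝ ∙ e)ᗮ.orthogonalProjectionOnto x)}
      = univ ×ˢ Iic (0 : ℝ) := by
    ext p
    rw [mem_preimage, mem_ofPred_eq, graphShear, inner_add_smul_self he,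
      orthogonalProjectionOnto_add_smul]
    simp
  rw [← (measurePreserving_graphShear he hg.continuous).setIntegral_preimage_emb
    (measurableEmbedding_graphShear he hg.continuous), hpre]
  refine (integral_congr_ae (ae_of_all _ fun p => ?_)).trans
    (h.trans (integral_congr_ae (ae_of_all _ fun y => ?_)))
  · have h1 : HasFDerivAt (graphShear e g)
        ((ℝ ∙ e)ᗮ.subtypeL ∘L ContinuousLinearMap.fst ℝ _ _
          + (fderiv ℝ g p.1 ∘L ContinuousLinearMap.fst ℝ _ _
            + ContinuousLinearMap.snd ℝ _ _).smulRight e) p := by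
      refine HasFDerivAt.add ((ℝ ∙ e)ᗮ.subtypeL.hasFDerivAt.comp p hasFDerivAt_fst) ?_
      exact ((((hg.differentiable one_ne_zero p.1).hasFDerivAt.comp p hasFDerivAt_fst)).add
        hasFDerivAt_snd).smul_const e
    have h2 := (hf.differentiable one_ne_zero (graphShear e g p)).hasFDerivAt.comp p h1
    rw [h2.fderiv, ContinuousLinearMap.comp_apply]
    congr 1
    rw [inner_graphNormal]
    -- The vertical component `⟪e, v⟫ - dg(w)` is exactly what makes the derivative of the shear
    -- send `(w, ⟪N, v⟫)` to `v`, where `N` is the unnormalised normal.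
    change v = (w : E) + (fderiv ℝ g p.1 w + (⟪e, v⟫_ℝ - fderiv ℝ g p.1 w)) • e
    rw [add_sub_cancel, orthogonalProjectionOnto_add_inner_smul he]
  · simp [graphShear, graphMap]

end Graph

/-! ### Local outer normals of a set with `C¹` boundary -/

/-- `ν` is an outer normal of `U` in the open set `O`, in the sense that the divergence theorem
holds for test functions supported in `O`. -/
def IsOuterNormalOn {d : ℕ} (U O : Set (EuclideanSpace ℝ (Fin d)))
    (ν : EuclideanSpace ℝ (Fin d) → EuclideanSpace ℝ (Fin d)) : Prop :=
  ∀ f : EuclideanSpace ℝ (Fin d) → ℝ, ContDiff ℝ 1 f → HasCompactSupport f → tsupport f ⊆ O →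
    ∀ v, ∫ x in U, fderiv ℝ f x v = ∫ x in frontier U, f x * ⟪ν x, v⟫_ℝ ∂μHE[d - 1]

section Graph

variable {E : Type*} [NormedAddCommGroup E] [InnerProductSpace ℝ E] [FiniteDimensional ℝ E]

/-- Strictly below or above the graph, a whole neighbourhood lies in `U` or in its complement. A
point on the graph is a limit of points of `U` from below and of points outside `U` from above. -/
theorem frontier_inter_ball_eq_range_graphMap {U : Set E} {x : E} {r : ℝ} {e : E} (he : ‖e‖ = 1)
    {g : (ℝ ∙ e)ᗮ → ℝ} (hg : Continuous g)
    (h : ∀ y ∈ Metric.ball x r,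
      (⟪e, y⟫_ℝ < g ((ℝ ∙ e)ᗮ.orthogonalProjectionOnto y) → y ∈ U) ∧
      (g ((ℝ ∙ e)ᗮ.orthogonalProjectionOnto y) < ⟪e, y⟫_ℝ → y ∉ U)) :
    frontier U ∩ Metric.ball x r = range (graphMap e g) ∩ Metric.ball x r := by
  have hc1 : Continuous fun y => ⟪e, y⟫_ℝ := continuous_const.inner continuous_id
  have hc2 : Continuous fun y => g ((ℝ ∙ e)ᗮ.orthogonalProjectionOnto y) :=
    hg.comp (ContinuousLinearMap.continuous _)
  ext y
  refine and_congr_left fun hy => ?_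
  have hball : ∀ᶠ z in 𝓝 y, z ∈ Metric.ball x r := Metric.isOpen_ball.mem_nhds hy
  rw [range_graphMap he, mem_ofPred_eq]
  constructor
  · intro hyU
    by_contra hne
    rcases lt_or_gt_of_ne hne with hlt | hlt
    · refine hyU.2 (mem_interior_iff_mem_nhds.2 ?_)
      filter_upwards [hball, hc1.continuousAt.eventually_lt hc2.continuousAt hlt] with z hz hz'
      exact (h z hz).1 hz'
    · refine (mem_closure_iff_frequently.1 hyU.1) ?_
      filter_upwards [hball, hc2.continuousAt.eventually_lt hc1.continuousAt hlt] with z hz hz'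
      exact (h z hz).2 hz'
  · intro hyg
    have hP : ∀ t : ℝ, (ℝ ∙ e)ᗮ.orthogonalProjectionOnto (y + t • e)
        = (ℝ ∙ e)ᗮ.orthogonalProjectionOnto y := fun t => by
      have h0 := orthogonalProjectionOnto_add_inner_smul he y
      conv_lhs => rw [← h0, add_assoc, ← add_smul]
      exact orthogonalProjectionOnto_add_smul e _ _
    have hI : ∀ t : ℝ, ⟪e, y + t • e⟫_ℝ = ⟪e, y⟫_ℝ + t := fun t => by
      rw [inner_add_right, inner_smul_right, real_inner_self_eq_norm_sq, he]
      simp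
    have hlim : Tendsto (fun t : ℝ => y + t • e) (𝓝 0) (𝓝 y) := by
      have : Continuous fun t : ℝ => y + t • e := by fun_prop
      simpa using this.tendsto 0
    rw [frontier_eq_closure_inter_closure]
    constructor
    · refine mem_closure_of_tendsto (hlim.mono_left (nhdsWithin_le_nhds (s := Iio 0))) ?_
      filter_upwards [self_mem_nhdsWithin,
        (hlim.mono_left nhdsWithin_le_nhds).eventually hball] with t ht hz
      refine (h _ hz).1 ?_
      rw [hP, hI, hyg]
      exact add_lt_of_neg_right _ ht
    · refine mem_closure_of_tendsto (hlim.mono_left (nhdsWithin_le_nhds (s := Ioi 0))) ?_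
      filter_upwards [self_mem_nhdsWithin,
        (hlim.mono_left nhdsWithin_le_nhds).eventually hball] with t ht hz
      refine (h _ hz).2 ?_
      rw [hP, hI, hyg]
      exact lt_add_of_pos_right _ ht

variable [MeasurableSpace E] [BorelSpace E]

/-- The part of the graph in a ball projects into a compact ball of the hyperplane, where the
continuous area density is integrable. -/
theorem euclideanHausdorffMeasure_range_graphMap_inter_ball_lt_top {e : E} (he : ‖e‖ = 1)
    {g : (ℝ ∙ e)ᗮ → ℝ} (hg : ContDiff ℝ 1 g) (x : E) (r : ℝ) :
    μHE[finrank ℝ E - 1] (range (graphMap e g) ∩ Metric.ball x r) < ∞ := by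
  have hG := (contDiff_graphMap hg).continuous
  rw [inter_comm, ← Measure.restrict_apply Metric.isOpen_ball.measurableSet,
    ← map_withDensity_graphNormal he hg,
    Measure.map_apply hG.measurable Metric.isOpen_ball.measurableSet,
    withDensity_apply _ (hG.measurable Metric.isOpen_ball.measurableSet)]
  have hsub : graphMap e g ⁻¹' Metric.ball x r
      ⊆ Metric.closedBall ((ℝ ∙ e)ᗮ.orthogonalProjectionOnto x) r := by
    intro y hy
    rw [mem_preimage, mem_ball_iff_norm] at hy
    rw [mem_closedBall_iff_norm, ← orthogonalProjectionOnto_graphMap e g y, ← map_sub]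
    exact (Submodule.norm_orthogonalProjectionOnto_apply_le _ _).trans hy.le
  refine (lintegral_mono_set hsub).trans_lt ?_
  exact ((continuous_graphNormal hg).norm.continuousOn.integrableOn_compact
    (isCompact_closedBall _ _)).lintegral_lt_top

end Graph

section Boundary

variable {d : ℕ} {U : Set (EuclideanSpace ℝ (Fin d))}

/-- The unit normal of the graph, extended constantly in direction `e`, is defined and continuous
everywhere. In the ball `U` agrees with the closed subgraph up to the graph itself, which is
Lebesgue null, so the divergence theorem below a graph applies. -/
theorem HasC1Boundary.exists_isOuterNormalOn (hU : HasC1Boundary U) (hUm : MeasurableSet U)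
    {x : EuclideanSpace ℝ (Fin d)} (hx : x ∈ frontier U) :
    ∃ r > 0, ∃ ν : EuclideanSpace ℝ (Fin d) → EuclideanSpace ℝ (Fin d), Continuous ν ∧
      (∀ y, ‖ν y‖ = 1) ∧ μHE[d - 1] (frontier U ∩ Metric.ball x r) < ∞ ∧
      IsOuterNormalOn U (Metric.ball x r) ν := by
  classical
  obtain ⟨e, he, g, hg, r, hr, h⟩ := hU x hx
  have hfr := frontier_inter_ball_eq_range_graphMap he hg.continuous h
  have hdim : finrank ℝ (EuclideanSpace ℝ (Fin d)) - 1 = d - 1 := by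
    rw [finrank_euclideanSpace_fin]
  set P := (ℝ ∙ e)ᗮ.orthogonalProjectionOnto
  have hNP : Continuous fun y => graphNormal e g (P y) :=
    (continuous_graphNormal hg).comp P.continuous
  have hne : ∀ y, ‖graphNormal e g (P y)‖ ≠ 0 := fun y =>
    norm_ne_zero_iff.2 (graphNormal_ne_zero he _)
  refine ⟨r, hr, fun y => ‖graphNormal e g (P y)‖⁻¹ • graphNormal e g (P y),
    (hNP.norm.inv₀ hne).smul hNP, fun y => ?_, ?_, fun f hf hfc hfs v => ?_⟩
  · rw [norm_smul, norm_inv, norm_norm, inv_mul_cancel₀ (hne y)]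
  · rw [hfr, ← hdim]
    exact euclideanHausdorffMeasure_range_graphMap_inter_ball_lt_top he hg x r
  · have hclosed : IsClosed {y | ⟪e, y⟫_ℝ ≤ g (P y)} :=
      isClosed_le (continuous_const.inner continuous_id) (hg.continuous.comp P.continuous)
    have hrange : IsClosed (range (graphMap e g)) := by
      rw [range_graphMap he]
      exact isClosed_eq (continuous_const.inner continuous_id) (hg.continuous.comp P.continuous)
    have h1 : ∫ y in U, fderiv ℝ f y v = ∫ y in {y | ⟪e, y⟫_ℝ ≤ g (P y)}, fderiv ℝ f y v := by
      rw [← integral_indicator hUm, ← integral_indicator hclosed.measurableSet]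
      have hnull : ∀ᵐ y, y ∉ range (graphMap e g) :=
        measure_eq_zero_iff_ae_notMem.1 (volume_range_graphMap he hg.continuous)
      refine integral_congr_ae ?_
      filter_upwards [hnull] with y hy
      by_cases hyf : y ∈ tsupport f
      · have hyb := h y (hfs hyf)
        rw [range_graphMap he, mem_ofPred_eq] at hy
        have hiff : y ∈ U ↔ y ∈ {y | ⟪e, y⟫_ℝ ≤ g (P y)} := by
          rcases lt_or_gt_of_ne hy with hlt | hlt
          · exact ⟨fun _ => hlt.le, fun _ => hyb.1 hlt⟩
          · exact ⟨fun hyU => absurd hyU (hyb.2 hlt), fun hle => absurd hlt (not_lt.2 hle)⟩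
        by_cases hyU : y ∈ U
        · rw [indicator_of_mem hyU, indicator_of_mem (hiff.1 hyU)]
        · rw [indicator_of_notMem hyU, indicator_of_notMem (mt hiff.2 hyU)]
      · have h0 : fderiv ℝ f y v = 0 := by
          rw [image_eq_zero_of_notMem_tsupport (mt (fun h => tsupport_fderiv_subset ℝ h) hyf)]
          rfl
        rw [indicator_apply, indicator_apply, h0, ite_self, ite_self]
    rw [h1, integral_fderiv_lt_graph he hg hf hfc, integral_inner_graphNormal he hg, hdim,
      ← integral_indicator hrange.measurableSet, ← integral_indicator isClosed_frontier.measurableSet]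
    congr 1
    ext y
    by_cases hy : y ∈ Metric.ball x r
    · have hiff : y ∈ range (graphMap e g) ↔ y ∈ frontier U := by
        have := Set.ext_iff.1 hfr y
        simp only [mem_inter_iff, hy, and_true] at this
        exact this.symm
      simp only [indicator_apply, hiff, P]
    · have h0 : f y = 0 := image_eq_zero_of_notMem_tsupport fun h => hy (hfs h)
      simp only [indicator_apply, h0, zero_mul, ite_self]

/-- Off `∂U` the cut-off function `1_U f` is still `C¹` with compact support, so its derivative
integrates to zero. The boundary integral vanishes as well, whatever `ν` is. -/
theorem isOuterNormalOn_compl_frontier (hUm : MeasurableSet U)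
    (ν : EuclideanSpace ℝ (Fin d) → EuclideanSpace ℝ (Fin d)) :
    IsOuterNormalOn U (frontier U)ᶜ ν := by
  intro f hf hfc hfs v
  have h0 : ∫ x in frontier U, f x * ⟪ν x, v⟫_ℝ ∂μHE[d - 1] = 0 := by
    refine setIntegral_eq_zero_of_forall_eq_zero fun x hx => ?_
    rw [image_eq_zero_of_notMem_tsupport fun h => hfs h hx, zero_mul]
  -- The second half of each alternative ensures that the derivative of `1_U f` at `x` equals the
  -- indicator of the derivative of `f`, also at boundary points outside the support.
  have hloc : ∀ x, U.indicator f =ᶠ[𝓝 x] f ∧ (x ∈ U ∨ x ∉ tsupport f) ∨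
      U.indicator f =ᶠ[𝓝 x] 0 ∧ (x ∉ U ∨ x ∉ tsupport f) := by
    intro x
    by_cases hx : x ∈ tsupport f
    · have hxU : x ∉ frontier U := hfs hx
      by_cases hxi : x ∈ interior U
      · left
        refine ⟨?_, Or.inl (interior_subset hxi)⟩
        filter_upwards [isOpen_interior.mem_nhds hxi] with y hy
        exact indicator_of_mem (interior_subset hy) _
      · right
        have hxc : x ∉ closure U := fun h => hxU ⟨h, hxi⟩
        refine ⟨?_, Or.inl fun h => hxc (subset_closure h)⟩
        filter_upwards [isClosed_closure.isOpen_compl.mem_nhds hxc] with y hy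
        exact indicator_of_notMem (fun h => hy (subset_closure h)) _
    · right
      refine ⟨?_, Or.inr hx⟩
      filter_upwards [(isClosed_tsupport f).isOpen_compl.mem_nhds hx] with y hy
      simp [image_eq_zero_of_notMem_tsupport hy]
  have hk : ContDiff ℝ 1 (U.indicator f) := by
    rw [contDiff_iff_contDiffAt]
    intro x
    rcases hloc x with h | h
    · exact hf.contDiffAt.congr_of_eventuallyEq h.1
    · exact contDiffAt_const.congr_of_eventuallyEq h.1
  have hkc : HasCompactSupport (U.indicator f) := hfc.mono' <| by
    refine (fun x hx => subset_tsupport f ?_)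
    intro h
    simp [h] at hx
  rw [h0, ← integral_indicator hUm, ← integral_fderiv_eq_zero_of_hasCompactSupport volume hk hkc v]
  congr 1
  ext x
  have hz : x ∉ tsupport f → fderiv ℝ f x = 0 := fun h =>
    image_eq_zero_of_notMem_tsupport (mt (fun h => tsupport_fderiv_subset ℝ h) h)
  rcases hloc x with ⟨h, hx⟩ | ⟨h, hx⟩
  · rw [h.fderiv_eq]
    rcases hx with hx | hx
    · rw [indicator_of_mem hx]
    · simp [hz hx]
  · rw [h.fderiv_eq]
    rcases hx with hx | hx
    · rw [indicator_of_notMem hx]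
      simp
    · simp [hz hx]

theorem HasC1Boundary.euclideanHausdorffMeasure_frontier_lt_top (hU : HasC1Boundary U)
    (hUm : MeasurableSet U) (hUc : IsCompact (frontier U)) : μHE[d - 1] (frontier U) < ∞ := by
  refine hUc.measure_lt_top_of_nhdsWithin fun x hx => ?_
  obtain ⟨r, hr, ν, -, -, h, -⟩ := hU.exists_isOuterNormalOn hUm hx
  exact ⟨_, inter_mem_nhdsWithin _ (Metric.ball_mem_nhds x hr), h⟩

end Boundary

/-! ### Flux through the whole boundary -/

/-- The divergence of a vector field on `ℝ^d`. -/
def euclideanDiv {d : ℕ} (φ : EuclideanSpace ℝ (Fin d) → EuclideanSpace ℝ (Fin d))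
    (x : EuclideanSpace ℝ (Fin d)) : ℝ :=
  ∑ j, fderiv ℝ (fun y => φ y j) x (EuclideanSpace.single j 1)

theorem exists_contDiff_eq_one_of_isCompact {E : Type*} [NormedAddCommGroup E] [NormedSpace ℝ E]
    [FiniteDimensional ℝ E] {K V : Set E} (hK : IsCompact K) (hV : IsOpen V) (hKV : K ⊆ V) :
    ∃ η : E → ℝ, ContDiff ℝ 1 η ∧ HasCompactSupport η ∧ tsupport η ⊆ V ∧ (∀ x ∈ K, η x = 1) ∧
      ∀ x, 0 ≤ η x ∧ η x ≤ 1 := by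
  obtain ⟨L, hL, hKL, hLV⟩ := exists_compact_between hK hV hKV
  obtain ⟨η, h1, h0, h01⟩ := exists_contMDiffMap_one_nhds_of_subset_interior
    (modelWithCornersSelf ℝ E) (n := 1) hK.isClosed hKL
  have hsupp : Function.support η ⊆ L := fun x hx => by
    by_contra hxL
    exact hx (h0 x hxL)
  have hts : tsupport η ⊆ L := closure_minimal hsupp hL.isClosed
  exact ⟨η, η.contMDiff.contDiff, HasCompactSupport.of_support_subset_isCompact hL hsupp,
    hts.trans hLV, fun x hx => h1.self_of_nhdsSet x hx, fun x => h01 x⟩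

section Boundary

variable {d : ℕ} {U : Set (EuclideanSpace ℝ (Fin d))}

theorem IsOuterNormalOn.mono {O O' : Set (EuclideanSpace ℝ (Fin d))}
    {ν : EuclideanSpace ℝ (Fin d) → EuclideanSpace ℝ (Fin d)} (h : IsOuterNormalOn U O ν)
    (hO : O' ⊆ O) : IsOuterNormalOn U O' ν :=
  fun f hf hfc hfs v => h f hf hfc (hfs.trans hO) v

/-- The flux through `∂U` of a vector field bounded by `M` is at most `M ℋ^{d-1}(∂U)`. -/
theorem HasC1Boundary.integral_euclideanDiv_le (hU : HasC1Boundary U) (hUm : MeasurableSet U)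
    (hUc : IsCompact (frontier U)) {φ : EuclideanSpace ℝ (Fin d) → EuclideanSpace ℝ (Fin d)}
    (hφ : ContDiff ℝ 1 φ) (hφc : HasCompactSupport φ) {M : ℝ} (hM : ∀ x, ‖φ x‖ ≤ M) :
    |∫ x in U, euclideanDiv φ x| ≤ M * (μHE[d - 1] (frontier U)).toReal := by
  have hfin := hU.euclideanHausdorffMeasure_frontier_lt_top hUm hUc
  have : IsFiniteMeasure (μHE[d - 1].restrict (frontier U)) := ⟨by simpa using hfin⟩
  choose r hr ν hνc hν1 hνf hνn using fun x (hx : x ∈ frontier U) =>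
    hU.exists_isOuterNormalOn hUm hx
  obtain ⟨t, ht⟩ := hUc.elim_nhds_subcover' (fun x hx => Metric.ball x (r x hx))
    fun x hx => Metric.ball_mem_nhds x (hr x hx)
  -- Finitely many balls cover `∂U`; the index `none` stands for the complement of `∂U`, where the
  -- choice of normal is irrelevant and 0 is taken.
  let O : Option t → Set (EuclideanSpace ℝ (Fin d)) := fun i =>
    i.elim (frontier U)ᶜ fun x => Metric.ball x.1 (r x.1 x.1.2)
  let n : Option t → EuclideanSpace ℝ (Fin d) → EuclideanSpace ℝ (Fin d) := fun i =>
    i.elim (fun _ => 0) fun x => ν x.1 x.1.2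
  have hOo : ∀ i, IsOpen (O i) := by
    rintro (_ | x)
    · exact isClosed_frontier.isOpen_compl
    · exact Metric.isOpen_ball
  have hOu : univ ⊆ ⋃ i, O i := by
    intro x _
    by_cases hx : x ∈ frontier U
    · obtain ⟨y, hy, hxy⟩ := mem_iUnion₂.1 (ht hx)
      exact mem_iUnion.2 ⟨some ⟨y, hy⟩, hxy⟩
    · exact mem_iUnion.2 ⟨none, hx⟩
  have hnc : ∀ i, Continuous (n i) := by
    rintro (_ | x)
    · exact continuous_const
    · exact hνc _ _
  have hn1 : ∀ i x, ‖n i x‖ ≤ 1 := by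
    rintro (_ | x) y
    · simp [n]
    · exact (hν1 _ _ y).le
  have hnn : ∀ i, IsOuterNormalOn U (O i) (n i) := by
    rintro (_ | x)
    · exact isOuterNormalOn_compl_frontier hUm _
    · exact hνn _ _
  obtain ⟨ρ, hρ⟩ := SmoothPartitionOfUnity.exists_isSubordinate
    (modelWithCornersSelf ℝ (EuclideanSpace ℝ (Fin d))) isClosed_univ O hOo hOu
  have hρd : ∀ i, ContDiff ℝ 1 (ρ i) := fun i => (ρ i).contMDiff.contDiff.of_le (by simp)
  have hρs : ∀ x, ∑ i, ρ i x = 1 := fun x => by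
    rw [← finsum_eq_sum_of_fintype]
    exact ρ.sum_eq_one (mem_univ x)
  have hφj : ∀ j, ContDiff ℝ 1 fun y => φ y j := fun j => (contDiff_piLp 2).1 hφ j
  have hφjc : ∀ j, HasCompactSupport fun y => φ y j := fun j =>
    hφc.comp_left (g := fun z : EuclideanSpace ℝ (Fin d) => z j) rfl
  have hfd : ∀ i j, ContDiff ℝ 1 fun y => ρ i y * φ y j := fun i j => (hρd i).mul (hφj j)
  have hfc : ∀ i j, HasCompactSupport fun y => ρ i y * φ y j := fun i j => (hφjc j).mul_left
  have hfs : ∀ i j, (tsupport fun y => ρ i y * φ y j) ⊆ O i := fun i j =>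
    (tsupport_mul_subset_left (f := ρ i)).trans (hρ i)
  have hint : ∀ i j v, Integrable (fun x => fderiv ℝ (fun y => ρ i y * φ y j) x v) := fun i j v =>
    (((hfd i j).continuous_fderiv one_ne_zero).clm_apply
      continuous_const).integrable_of_hasCompactSupport ((hfc i j).fderiv_apply ℝ v)
  have hint' : ∀ i j v, Integrable (fun x => ρ i x * φ x j * ⟪n i x, v⟫_ℝ)
      (μHE[d - 1].restrict (frontier U)) := fun i j v =>
    ((hfd i j).continuous.mul ((hnc i).inner continuous_const)).integrable_of_hasCompactSupport
      (hfc i j).mul_right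
  have hdiv : ∀ x, euclideanDiv φ x = ∑ j, ∑ i,
      fderiv ℝ (fun y => ρ i y * φ y j) x (EuclideanSpace.single j 1) := fun x => by
    refine Finset.sum_congr rfl fun j _ => ?_
    have h1 : (fun y => φ y j) = fun y => ∑ i, ρ i y * φ y j := by
      ext y
      rw [← Finset.sum_mul, hρs, one_mul]
    conv_lhs => rw [h1]
    rw [fderiv_fun_sum fun i _ => (hfd i j).differentiable one_ne_zero x,
      sum_apply]
  have hkey : ∫ x in U, euclideanDiv φ x = ∫ x in frontier U,
      ∑ j, ∑ i, ρ i x * φ x j * ⟪n i x, EuclideanSpace.single j 1⟫_ℝ ∂μHE[d - 1] := by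
    simp only [hdiv]
    rw [integral_finsetSum _ fun j _ => integrable_finsetSum _ fun i _ => (hint i j _).integrableOn,
      integral_finsetSum _ fun j _ => integrable_finsetSum _ fun i _ => hint' i j _]
    refine Finset.sum_congr rfl fun j _ => ?_
    rw [integral_finsetSum _ fun i _ => (hint i j _).integrableOn,
      integral_finsetSum _ fun i _ => hint' i j _]
    exact Finset.sum_congr rfl fun i _ => hnn i _ (hfd i j) (hfc i j) (hfs i j) _
  rw [hkey, ← Real.norm_eq_abs]
  refine norm_setIntegral_le_of_norm_le_const hfin fun x _ => ?_
  have hpt : ∑ j, ∑ i, ρ i x * φ x j * ⟪n i x, EuclideanSpace.single j 1⟫_ℝ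
      = ∑ i, ρ i x * ⟪n i x, φ x⟫_ℝ := by
    rw [Finset.sum_comm]
    refine Finset.sum_congr rfl fun i _ => ?_
    rw [PiLp.inner_apply, Finset.mul_sum]
    refine Finset.sum_congr rfl fun j _ => ?_
    simp [EuclideanSpace.inner_single_right]
    ring
  rw [hpt]
  -- Only lengths of the local normals enter, weighted by the partition of unity; their agreement on
  -- overlaps is not needed.
  refine (norm_sum_le _ _).trans ?_
  calc ∑ i, ‖ρ i x * ⟪n i x, φ x⟫_ℝ‖ ≤ ∑ i, ρ i x * M := by
        refine Finset.sum_le_sum fun i _ => ?_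
        rw [norm_mul, Real.norm_of_nonneg (ρ.nonneg i x)]
        refine mul_le_mul_of_nonneg_left ?_ (ρ.nonneg i x)
        refine (norm_inner_le_norm _ _).trans ?_
        exact (mul_le_of_le_one_left (norm_nonneg _) (hn1 i x)).trans (hM x)
    _ = M := by rw [← Finset.sum_mul, hρs, one_mul]

/-- Each `V i` consists of the points strictly nearer to `K i` than to every other set. The distance
to an empty set is infinite, so empty sets need no separate treatment. -/
theorem exists_pairwise_disjoint_isOpen {X ι : Type*} [MetricSpace X] [Finite ι] {K : ι → Set X}
    (hK : ∀ i, IsCompact (K i)) (hd : Pairwise fun i j => Disjoint (K i) (K j)) :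
    ∃ V : ι → Set X, (∀ i, IsOpen (V i)) ∧ (∀ i, K i ⊆ V i) ∧
      Pairwise fun i j => Disjoint (V i) (V j) := by
  refine ⟨fun i => {x | ∀ j, j ≠ i → Metric.infEDist x (K i) < Metric.infEDist x (K j)},
    fun i => ?_, fun i x hx j hj => ?_, fun i j hij => ?_⟩
  · simp only [ofPred_forall]
    refine isOpen_iInter_of_finite fun j => isOpen_iInter_of_finite fun _ => ?_
    exact isOpen_lt Metric.continuous_infEDist Metric.continuous_infEDist
  · rw [Metric.infEDist_zero_of_mem hx]
    refine Metric.infEDist_pos_iff_notMem_closure.2 ?_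
    rw [(hK j).isClosed.closure_eq]
    exact disjoint_left.1 (hd hj.symm) hx
  · refine disjoint_left.2 fun x hi hj => ?_
    exact lt_asymm (hi j hij.symm) (hj i hij)

/-- There are vector fields bounded by `1`, supported near `∂U`, whose flux through `∂U` is
arbitrarily close to `ℋ^{d-1}(∂U)`. -/
theorem HasC1Boundary.exists_le_integral_euclideanDiv (hU : HasC1Boundary U) (hUm : MeasurableSet U)
    (hUc : IsCompact (frontier U)) {Ω : Set (EuclideanSpace ℝ (Fin d))} (hΩ : IsOpen Ω)
    (hUΩ : frontier U ⊆ Ω) {ε : ℝ} (hε : 0 < ε) :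
    ∃ ψ : EuclideanSpace ℝ (Fin d) → EuclideanSpace ℝ (Fin d), ContDiff ℝ 1 ψ ∧
      HasCompactSupport ψ ∧ tsupport ψ ⊆ Ω ∧ (∀ x, ‖ψ x‖ ≤ 1) ∧
      (μHE[d - 1] (frontier U)).toReal - ε ≤ ∫ x in U, euclideanDiv ψ x := by
  have hfin := hU.euclideanHausdorffMeasure_frontier_lt_top hUm hUc
  set m : Measure (EuclideanSpace ℝ (Fin d)) := μHE[d - 1].restrict (frontier U) with hm
  have : IsFiniteMeasure m := ⟨by simpa [hm] using hfin⟩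
  set h : ℝ := (μHE[d - 1] (frontier U)).toReal with hh
  have hh0 : 0 ≤ h := ENNReal.toReal_nonneg
  -- The error is split in halves: tilting of the normal costs `δ h ≤ ε / 2`, and passing to compact
  -- pieces costs another `ε / 2`. The `+ 1` keeps denominators positive when `h` or the number of
  -- pieces is 0.
  set δ : ℝ := min 1 (ε / (2 * (h + 1))) with hδ
  have hδ0 : 0 < δ := lt_min one_pos (by positivity)
  have hδ1 : δ ≤ 1 := min_le_left _ _
  have hδh : δ * h ≤ ε / 2 := by
    have h1 : δ * (2 * (h + 1)) ≤ ε := by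
      rw [← le_div_iff₀ (by positivity)]
      exact min_le_right _ _
    nlinarith
  -- The normal is only continuous, hence not itself an admissible `C¹` field; on small balls it is
  -- replaced by the constant vector `n`, its value at the centre.
  have hloc : ∀ x (_ : x ∈ frontier U), ∃ r > 0, ∃ ν, ∃ n : EuclideanSpace ℝ (Fin d),
      Continuous ν ∧ ‖n‖ = 1 ∧ Metric.ball x r ⊆ Ω ∧ IsOuterNormalOn U (Metric.ball x r) ν ∧
      ∀ y ∈ Metric.ball x r, 1 - δ ≤ ⟪ν y, n⟫_ℝ := by
    intro x hx
    obtain ⟨r, hr, ν, hνc, hν1, -, hν⟩ := hU.exists_isOuterNormalOn hUm hx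
    have h1 : ∀ᶠ y in 𝓝 x, 1 - δ < ⟪ν y, ν x⟫_ℝ := by
      refine continuousAt_const.eventually_lt (hνc.inner continuous_const).continuousAt ?_
      rw [real_inner_self_eq_norm_sq, hν1]
      linarith
    obtain ⟨s, hs, hsb⟩ := Metric.mem_nhds_iff.1
      (inter_mem h1 (inter_mem (hΩ.mem_nhds (hUΩ hx)) (Metric.ball_mem_nhds x hr)))
    exact ⟨s, hs, ν, ν x, hνc, hν1 x, fun y hy => (hsb hy).2.1,
      hν.mono fun y hy => (hsb hy).2.2, fun y hy => (hsb hy).1.le⟩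
  choose r hr ν' n' hν'c hn'1 hΩ' hν'n hν'δ using hloc
  obtain ⟨t, ht⟩ := hUc.elim_nhds_subcover' (fun x hx => Metric.ball x (r x hx))
    fun x hx => Metric.ball_mem_nhds x (hr x hx)
  set k := t.card
  let x : Fin k → frontier U := fun i => (t.equivFin.symm i).1
  let B : Fin k → Set (EuclideanSpace ℝ (Fin d)) := fun i => Metric.ball (x i) (r (x i) (x i).2)
  let A : Fin k → Set (EuclideanSpace ℝ (Fin d)) := disjointed B
  have hBm : ∀ i, MeasurableSet (B i) := fun i => Metric.isOpen_ball.measurableSet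
  have hAm : ∀ i, MeasurableSet (A i) := fun i => by
    exact disjointedRec (fun {t} i ht => ht.diff (hBm i)) (hBm i)
  have hAu : frontier U ⊆ ⋃ i, A i := by
    rw [iUnion_disjointed]
    intro y hy
    obtain ⟨z, hz, hyz⟩ := mem_iUnion₂.1 (ht hy)
    refine mem_iUnion.2 ⟨t.equivFin ⟨z, hz⟩, ?_⟩
    simpa [B, x] using hyz
  have hAd : Pairwise fun i j => Disjoint (A i) (A j) := disjoint_disjointed B
  have hε' : ENNReal.ofReal (ε / (2 * (k + 1))) ≠ 0 := by
    rw [Ne, ENNReal.ofReal_eq_zero, not_le]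
    positivity
  -- Inner regularity: disjoint measurable pieces are shrunk to compact ones, which have disjoint
  -- open neighbourhoods, so cut-offs with disjoint supports exist.
  choose K hKA hKc hKm using fun i => (hAm i).exists_isCompact_lt_add (measure_ne_top m _) hε'
  obtain ⟨V, hVo, hKV, hVd⟩ := exists_pairwise_disjoint_isOpen hKc
    fun i j hij => (hAd hij).mono (hKA i) (hKA j)
  have hKB : ∀ i, K i ⊆ V i ∩ B i := fun i =>
    subset_inter (hKV i) ((hKA i).trans (disjointed_subset B i))
  choose η hηd hηc hηs hη1 hη01 using fun i => exists_contDiff_eq_one_of_isCompact (hKc i)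
    ((hVo i).inter Metric.isOpen_ball) (hKB i)
  let n : Fin k → EuclideanSpace ℝ (Fin d) := fun i => n' (x i) (x i).2
  have hts : tsupport (fun y => ∑ i, η i y • n i) ⊆ ⋃ i, tsupport (η i) := by
    refine closure_minimal (fun y hy => ?_) (isClosed_iUnion_of_finite fun i => isClosed_tsupport _)
    obtain ⟨i, -, hi⟩ := Finset.exists_ne_zero_of_sum_ne_zero hy
    exact mem_iUnion.2 ⟨i, subset_tsupport _ (left_ne_zero_of_smul hi)⟩
  refine ⟨fun y => ∑ i, η i y • n i, ContDiff.sum fun i _ => (hηd i).smul contDiff_const, ?_,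
    hts.trans (iUnion_subset fun i => (hηs i).trans (inter_subset_right.trans (hΩ' _ _))),
    fun y => ?_, ?_⟩
  · exact HasCompactSupport.of_support_subset_isCompact
      (isCompact_iUnion fun i => (hηc i).isCompact) ((subset_tsupport _).trans hts)
  -- At most one cut-off is nonzero at `y`, so the sum never exceeds length 1.
  · by_cases hy : ∃ i, η i y ≠ 0
    · obtain ⟨i, hi⟩ := hy
      have hyi := (hηs i (subset_tsupport _ hi)).1
      dsimp only
      rw [Finset.sum_eq_single i (fun j _ hj => ?_) (by simp)]
      · rw [norm_smul, hn'1, mul_one, Real.norm_of_nonneg (hη01 i y).1]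
        exact (hη01 i y).2
      · have : η j y = 0 := image_eq_zero_of_notMem_tsupport fun h =>
          disjoint_left.1 (hVd hj) (hηs j h).1 hyi
        rw [this, zero_smul]
    · push Not at hy
      simp [hy]
  · have hint : ∀ i v, Integrable (fun y => fderiv ℝ (η i) y v) := fun i v =>
      (((hηd i).continuous_fderiv one_ne_zero).clm_apply
        continuous_const).integrable_of_hasCompactSupport ((hηc i).fderiv_apply ℝ v)
    have hdiv : ∀ y, euclideanDiv (fun y => ∑ i, η i y • n i) y = ∑ i, fderiv ℝ (η i) y (n i) := by
      intro y
      have h1 : ∀ j, fderiv ℝ (fun y => (∑ i, η i y • n i) j) y (EuclideanSpace.single j 1)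
          = ∑ i, n i j * fderiv ℝ (η i) y (EuclideanSpace.single j 1) := fun j => by
        have h2 : (fun y => (∑ i, η i y • n i) j) = fun y => ∑ i, η i y * n i j := by
          ext z
          simp
        rw [h2, fderiv_fun_sum fun i _ =>
          ((hηd i).differentiable one_ne_zero y).mul_const (n i j), sum_apply]
        refine Finset.sum_congr rfl fun i _ => ?_
        rw [fderiv_mul_const ((hηd i).differentiable one_ne_zero y)]
        rfl
      rw [euclideanDiv, Finset.sum_congr rfl fun j _ => h1 j, Finset.sum_comm]
      refine Finset.sum_congr rfl fun i _ => ?_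
      conv_rhs => rw [← (EuclideanSpace.basisFun (Fin d) ℝ).sum_repr (n i)]
      simp [map_sum]
    have hflux : ∀ i, (1 - δ) * m.real (K i) ≤ ∫ y in U, fderiv ℝ (η i) y (n i) := by
      intro i
      rw [hν'n (x i) (x i).2 (η i) (hηd i) (hηc i) ((hηs i).trans inter_subset_right)]
      have h1 : m.real (K i) ≤ ∫ y, η i y ∂m := by
        rw [← integral_indicator_one (hKc i).measurableSet]
        refine integral_mono ((integrable_const (1 : ℝ)).indicator (hKc i).measurableSet)
          ((hηd i).continuous.integrable_of_hasCompactSupport (hηc i)) fun y => ?_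
        by_cases hy : y ∈ K i
        · simp [hy, hη1 i y hy]
        · simpa [hy] using (hη01 i y).1
      refine (mul_le_mul_of_nonneg_left h1 (sub_nonneg.2 hδ1)).trans ?_
      rw [← integral_const_mul]
      refine integral_mono
        (((hηd i).continuous.integrable_of_hasCompactSupport (hηc i)).const_mul _)
        (((hηd i).continuous.mul ((hν'c (x i) (x i).2).inner
          continuous_const)).integrable_of_hasCompactSupport (hηc i).mul_right) fun y => ?_
      by_cases hy : y ∈ tsupport (η i)
      · dsimp only
        rw [mul_comm]
        exact mul_le_mul_of_nonneg_left (hν'δ _ _ y (hηs i hy).2) (hη01 i y).1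
      · simp [image_eq_zero_of_notMem_tsupport hy]
    simp only [hdiv]
    rw [integral_finsetSum _ fun i _ => (hint i _).integrableOn]
    refine le_trans ?_ (Finset.sum_le_sum fun i _ => hflux i)
    rw [← Finset.mul_sum]
    have hKle : ∀ i, m.real (A i) - ε / (2 * (k + 1)) ≤ m.real (K i) := fun i => by
      have h1 := (ENNReal.toReal_le_toReal (measure_ne_top m _) (by finiteness)).2 (hKm i).le
      rw [ENNReal.toReal_add (measure_ne_top m _) ENNReal.ofReal_ne_top,
        ENNReal.toReal_ofReal (by positivity)] at h1
      rw [sub_le_iff_le_add]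
      exact h1
    have hmA : ∑ i, m.real (A i) = h := by
      rw [← measureReal_iUnion_fintype hAd hAm, measureReal_def, hm,
        Measure.restrict_apply (MeasurableSet.iUnion hAm), inter_eq_self_of_subset_right hAu]
    have hmK : ∑ i, m.real (K i) ≤ h := by
      rw [← hmA]
      exact Finset.sum_le_sum fun i _ => measureReal_mono (hKA i)
    have hmK' : h - ε / 2 ≤ ∑ i, m.real (K i) := by
      refine le_trans ?_ (Finset.sum_le_sum fun i _ => hKle i)
      rw [Finset.sum_sub_distrib, hmA, Finset.sum_const, Finset.card_univ, Fintype.card_fin,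
        nsmul_eq_mul]
      have : (k : ℝ) * (ε / (2 * (k + 1))) ≤ ε / 2 := by
        rw [mul_div_assoc', div_le_div_iff₀ (by positivity) (by positivity)]
        nlinarith
      linarith
    nlinarith

end Boundary

/-! ### Compactness of the sphere, Lipschitz spaces and `W₁` -/

/-- The identity from the sphere with its Euclidean topology is continuous, since angles are
continuous away from the origin; compactness is carried over. -/
instance S2.instCompactSpace : CompactSpace S2 := by
  let f : Metric.sphere (0 : EuclideanSpace ℝ (Fin 3)) 1 → S2 := id
  have hne : ∀ y : Metric.sphere (0 : EuclideanSpace ℝ (Fin 3)) 1,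
      (y : EuclideanSpace ℝ (Fin 3)) ≠ 0 := fun y => ne_zero_of_mem_unit_sphere y
  have hf : Continuous f := by
    refine continuous_iff_continuousAt.2 fun x => tendsto_iff_dist_tendsto_zero.2 ?_
    have h1 : ContinuousAt (fun y : Metric.sphere (0 : EuclideanSpace ℝ (Fin 3)) 1 =>
        InnerProductGeometry.angle (y : EuclideanSpace ℝ (Fin 3)) x) x :=
      ContinuousAt.comp (f := fun y : Metric.sphere (0 : EuclideanSpace ℝ (Fin 3)) 1 =>
          ((y : EuclideanSpace ℝ (Fin 3)), (x : EuclideanSpace ℝ (Fin 3))))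
        (InnerProductGeometry.continuousAt_angle (hne x) (hne x)) (by fun_prop)
    have h2 := h1.tendsto
    rwa [InnerProductGeometry.angle_self (hne x)] at h2
  exact ⟨image_univ_of_surjective (f := f) Function.surjective_id ▸ isCompact_univ.image hf⟩

section Lip0

variable {X : Type*} [MetricSpace X] {x₀ : X}

/-- The inclusion of `Lip₀(X)` into the functions on `X`. -/
def Lip0.coeLM (x₀ : X) : Lip0 x₀ →ₗ[ℝ] X → ℝ := (lip0Submodule x₀).subtype

theorem Lip0.abs_sub_le (q : Lip0 x₀) (y z : X) : |q y - q z| ≤ ‖q‖ * dist y z :=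
  norm_sub_le_lipConst q.2.2 y z

theorem Lip0.continuous (q : Lip0 x₀) : Continuous q := by
  obtain ⟨K, hK⟩ := q.2.2
  exact hK.continuous

theorem norm_toLp_sub_le_productLipNorm {d : ℕ} (p : Fin d → Lip0 x₀) (y z : X) :
    ‖(WithLp.toLp 2 fun i => p i y : EuclideanSpace ℝ (Fin d)) - WithLp.toLp 2 fun i => p i z‖
      ≤ productLipNorm p * dist y z := by
  rw [EuclideanSpace.norm_eq, productLipNorm, ← Real.sqrt_sq (dist_nonneg (x := y) (y := z)),
    ← Real.sqrt_mul (Finset.sum_nonneg fun i _ => sq_nonneg _), Finset.sum_mul]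
  refine Real.sqrt_le_sqrt (Finset.sum_le_sum fun i _ => ?_)
  rw [← mul_pow]
  exact pow_le_pow_left₀ (norm_nonneg _) ((p i).abs_sub_le y z) 2

theorem coupledLipNorm_le_productLipNorm {d : ℕ} (p : Fin d → Lip0 x₀) :
    coupledLipNorm p ≤ productLipNorm p :=
  lipConst_le (Real.sqrt_nonneg _) (norm_toLp_sub_le_productLipNorm p)

theorem norm_toLp_sub_le_coupledLipNorm {d : ℕ} (p : Fin d → Lip0 x₀) (y z : X) :
    ‖(WithLp.toLp 2 fun i => p i y : EuclideanSpace ℝ (Fin d)) - WithLp.toLp 2 fun i => p i z‖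
      ≤ coupledLipNorm p * dist y z := by
  refine norm_sub_le_lipConst
    (f := fun z : X => (WithLp.toLp 2 fun i => p i z : EuclideanSpace ℝ (Fin d)))
    ⟨⟨productLipNorm p, Real.sqrt_nonneg _⟩, LipschitzWith.of_dist_le_mul fun y z => ?_⟩ y z
  rw [dist_eq_norm]
  exact norm_toLp_sub_le_productLipNorm p y z

variable [CompactSpace X] [MeasurableSpace X] [BorelSpace X]

theorem Lip0.integrable (μ : ProbabilityMeasure X) (q : Lip0 x₀) :
    Integrable q (μ : Measure X) :=
  q.continuous.integrable_of_hasCompactSupport (HasCompactSupport.of_compactSpace _)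

/-- Integration of functions in `Lip₀(X)` against a probability measure. -/
def Lip0.integralCLM (x₀ : X) (μ : ProbabilityMeasure X) : Lip0 x₀ →L[ℝ] ℝ :=
  LinearMap.mkContinuous
    { toFun := fun q => ∫ z, q z ∂(μ : Measure X)
      map_add' := fun f g => integral_add (f.integrable μ) (g.integrable μ)
      map_smul' := fun c f => integral_const_mul c _ }
    (Metric.diam (univ : Set X)) fun q => by
      have h : ∀ z, ‖q z‖ ≤ Metric.diam (univ : Set X) * ‖q‖ := fun z => by
        have h1 := q.abs_sub_le z x₀
        have h0 : q x₀ = 0 := q.2.1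
        rw [h0, sub_zero] at h1
        refine h1.trans ?_
        rw [mul_comm]
        exact mul_le_mul_of_nonneg_right
          (Metric.dist_le_diam_of_mem isCompact_univ.isBounded (mem_univ z) (mem_univ x₀))
          (norm_nonneg q)
      have h2 := norm_integral_le_of_norm_le_const (μ := (μ : Measure X)) (ae_of_all _ h)
      rwa [probReal_univ, mul_one] at h2

theorem Lip0.integralCLM_apply (μ : ProbabilityMeasure X) (q : Lip0 x₀) :
    Lip0.integralCLM x₀ μ q = ∫ z, q z ∂(μ : Measure X) := rfl

/-- Duality with the potential normalised at `x₀`: subtracting `q x₀` changes both integrals by the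
same constant. -/
theorem exists_lip0_le_integral_sub (x₀ : X) (μ ν : ProbabilityMeasure X)
    {c : ℝ} (hc : ENNReal.ofReal c < wasserstein1 μ ν) :
    ∃ q : Lip0 x₀, ‖q‖ ≤ 1 ∧ c < Lip0.integralCLM x₀ μ q - Lip0.integralCLM x₀ ν q := by
  by_contra! h
  refine hc.not_ge (wasserstein1_le_of_forall_lipschitzWith fun q hq => ?_)
  let q₀ : Lip0 x₀ := ⟨fun x => q x - q x₀, by simp, 1, by simpa using hq.sub (.const (q x₀))⟩
  have hq₀ : ‖q₀‖ ≤ 1 := lipConst_le zero_le_one fun x y => by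
    have : q₀.1 x - q₀.1 y = q x - q y := sub_sub_sub_cancel_right _ _ _
    change ‖q₀.1 x - q₀.1 y‖ ≤ _
    rw [this, ← dist_eq_norm]
    simpa using hq.dist_le_mul x y
  have hi : ∀ m : ProbabilityMeasure X, Lip0.integralCLM x₀ m q₀ = ∫ x, q x ∂(m : Measure X) - q x₀ :=
    fun m => by
      have : Integrable q (m : Measure X) :=
        hq.continuous.integrable_of_hasCompactSupport (HasCompactSupport.of_compactSpace _)
      rw [Lip0.integralCLM_apply]
      change ∫ x, (q x - q x₀) ∂(m : Measure X) = _
      rw [integral_sub this (integrable_const _)]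
      simp
  have := h q₀ hq₀
  rw [hi, hi] at this
  linarith

/-- By duality an infinite value would make the bounded functional `q ↦ ∫ q dμ - ∫ q dν` exceed its
own norm on the unit ball. -/
theorem wasserstein1_lt_top (μ ν : ProbabilityMeasure X) : wasserstein1 μ ν < ∞ := by
  obtain ⟨x₀⟩ : Nonempty X := (μ : Measure X).nonempty_of_neZero
  by_contra! h
  rw [top_le_iff] at h
  set C := ‖Lip0.integralCLM x₀ μ - Lip0.integralCLM x₀ ν‖
  obtain ⟨q, hq, hqC⟩ := exists_lip0_le_integral_sub x₀ μ ν (c := C)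
    (h ▸ ENNReal.ofReal_lt_top)
  have h1 := (Lip0.integralCLM x₀ μ - Lip0.integralCLM x₀ ν).le_of_opNorm_le_of_le le_rfl hq
  rw [mul_one] at h1
  exact absurd hqC (not_lt.2 ((le_abs_self _).trans h1))

/-- Pair the vector with the unit vector `a` in its own direction: its length is the integral
difference of `∑ aᵢ pᵢ`, which is 1-Lipschitz by Cauchy–Schwarz. This is where the coupled norm is
the natural one. -/
theorem norm_integralCLM_sub_le (μ ν : ProbabilityMeasure X) {d : ℕ} (p : Fin d → Lip0 x₀)
    (hp : coupledLipNorm p ≤ 1) :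
    ‖(WithLp.toLp 2 fun i => Lip0.integralCLM x₀ μ (p i) - Lip0.integralCLM x₀ ν (p i) :
      EuclideanSpace ℝ (Fin d))‖ ≤ (wasserstein1 μ ν).toReal := by
  set φ : EuclideanSpace ℝ (Fin d) :=
    WithLp.toLp 2 fun i => Lip0.integralCLM x₀ μ (p i) - Lip0.integralCLM x₀ ν (p i) with hφ
  rcases eq_or_ne φ 0 with h | h
  · rw [h, norm_zero]
    exact ENNReal.toReal_nonneg
  set a : EuclideanSpace ℝ (Fin d) := ‖φ‖⁻¹ • φ with ha
  have ha1 : ‖a‖ = 1 := by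
    rw [ha, norm_smul, norm_inv, norm_norm, inv_mul_cancel₀ (norm_ne_zero_iff.2 h)]
  let q : Lip0 x₀ := ∑ i, a i • p i
  have hq : ∀ z, q z = ⟪(WithLp.toLp 2 fun i => p i z : EuclideanSpace ℝ (Fin d)), a⟫_ℝ := fun z => by
    have h1 : q z = (∑ i, a i • Lip0.coeLM x₀ (p i)) z := by
      simp only [← map_smul, ← map_sum]
      rfl
    rw [h1, Finset.sum_apply, PiLp.inner_apply]
    rfl
  have hql : ∀ y z, q y - q z ≤ dist y z := fun y z => by
    rw [hq, hq, ← inner_sub_left]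
    refine (real_inner_le_norm _ _).trans ?_
    rw [ha1, mul_one]
    refine (norm_toLp_sub_le_coupledLipNorm p y z).trans ?_
    exact mul_le_of_le_one_left dist_nonneg hp
  have h1 := ofReal_integral_sub_le_wasserstein1 hql q.continuous.measurable (q.integrable μ)
    (q.integrable ν)
  rw [ENNReal.ofReal_le_iff_le_toReal (wasserstein1_lt_top μ ν).ne] at h1
  refine le_trans (le_of_eq ?_) h1
  rw [← Lip0.integralCLM_apply, ← Lip0.integralCLM_apply, map_sum, map_sum, ← Finset.sum_sub_distrib]
  have h2 : ‖φ‖ = ⟪φ, a⟫_ℝ := by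
    rw [ha, inner_smul_right, real_inner_self_eq_norm_sq, sq,
      inv_mul_cancel_left₀ (norm_ne_zero_iff.2 h)]
  rw [h2, PiLp.inner_apply]
  refine Finset.sum_congr rfl fun i _ => ?_
  rw [map_smul, map_smul, ← smul_sub]
  rfl

end Lip0

/-! ### The two bounds for the total variation -/

section TV

variable {X : Type*} [MetricSpace X] {x₀ : X} {d : ℕ}

theorem contDiff_apply_lip0 (L : Lip0 x₀ →L[ℝ] ℝ) {p : EuclideanSpace ℝ (Fin d) → Fin d → Lip0 x₀}
    (hp : ContDiff ℝ 1 p) (i : Fin d) : ContDiff ℝ 1 fun y => L (p y i) :=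
  L.contDiff.comp (contDiff_pi.1 hp i)

theorem hasCompactSupport_apply_lip0 (L : Lip0 x₀ →L[ℝ] ℝ)
    {p : EuclideanSpace ℝ (Fin d) → Fin d → Lip0 x₀}
    (hp : HasCompactSupport p) (i : Fin d) : HasCompactSupport fun y => L (p y i) :=
  hp.comp_left (g := fun z : Fin d → Lip0 x₀ => L (z i)) (map_zero L)

theorem map_lipDiv (L : Lip0 x₀ →L[ℝ] ℝ) {p : EuclideanSpace ℝ (Fin d) → Fin d → Lip0 x₀}
    (hp : ContDiff ℝ 1 p) (x : EuclideanSpace ℝ (Fin d)) :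
    L (lipDiv p x) = ∑ i, fderiv ℝ (fun y => L (p y i)) x (EuclideanSpace.single i 1) := by
  rw [lipDiv, map_sum]
  refine Finset.sum_congr rfl fun i _ => ?_
  have h : HasFDerivAt (fun y => L (p y i)) ((L ∘L ContinuousLinearMap.proj i) ∘L fderiv ℝ p x) x :=
    (L ∘L ContinuousLinearMap.proj i : (Fin d → Lip0 x₀) →L[ℝ] ℝ).hasFDerivAt.comp x
      (hp.differentiable one_ne_zero x).hasFDerivAt
  rw [h.fderiv]
  rfl

theorem integrable_map_lipDiv (L : Lip0 x₀ →L[ℝ] ℝ)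
    {p : EuclideanSpace ℝ (Fin d) → Fin d → Lip0 x₀}
    (hp : ContDiff ℝ 1 p) (hpc : HasCompactSupport p) :
    Integrable fun x => L (lipDiv p x) := by
  simp only [map_lipDiv L hp]
  refine integrable_finsetSum _ fun i _ => ?_
  exact (((contDiff_apply_lip0 L hp i).continuous_fderiv one_ne_zero).clm_apply
    continuous_const).integrable_of_hasCompactSupport
      ((hasCompactSupport_apply_lip0 L hpc i).fderiv_apply ℝ _)

theorem integral_map_lipDiv_eq_zero (L : Lip0 x₀ →L[ℝ] ℝ)
    {p : EuclideanSpace ℝ (Fin d) → Fin d → Lip0 x₀}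
    (hp : ContDiff ℝ 1 p) (hpc : HasCompactSupport p) :
    ∫ x, L (lipDiv p x) = 0 := by
  simp only [map_lipDiv L hp]
  rw [integral_finsetSum]
  · exact Finset.sum_eq_zero fun i _ => integral_fderiv_eq_zero_of_hasCompactSupport volume
      (contDiff_apply_lip0 L hp i) (hasCompactSupport_apply_lip0 L hpc i) _
  · exact fun i _ => (((contDiff_apply_lip0 L hp i).continuous_fderiv one_ne_zero).clm_apply
      continuous_const).integrable_of_hasCompactSupport
        ((hasCompactSupport_apply_lip0 L hpc i).fderiv_apply ℝ _)

theorem lipDiv_eq_zero_of_notMem_tsupport {p : EuclideanSpace ℝ (Fin d) → Fin d → Lip0 x₀}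
    {x : EuclideanSpace ℝ (Fin d)} (hx : x ∉ tsupport p) : lipDiv p x = 0 := by
  have : fderiv ℝ p x = 0 :=
    image_eq_zero_of_notMem_tsupport (mt (fun h => tsupport_fderiv_subset ℝ h) hx)
  simp [lipDiv, this]

variable [CompactSpace X] [MeasurableSpace X] [BorelSpace X]
  {Ω U : Set (EuclideanSpace ℝ (Fin d))} {uplus uminus : ProbabilityMeasure X}
  {u : EuclideanSpace ℝ (Fin d) → ProbabilityMeasure X}

/-- Split `u` as `uminus` plus the jump on `U`. The first part extends to an integral of a
divergence over all of `ℝ^d`, which is zero by compact support. -/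
theorem integral_lipDiv_eq (hΩ : IsOpen Ω) (hUm : MeasurableSet U) (hUΩ : U ⊆ Ω)
    (hu_plus : ∀ x ∈ U, u x = uplus) (hu_minus : ∀ x ∈ Ω \ U, u x = uminus)
    {p : EuclideanSpace ℝ (Fin d) → Fin d → Lip0 x₀} (hp : ContDiff ℝ 1 p)
    (hpc : HasCompactSupport p) (hpΩ : tsupport p ⊆ Ω) :
    ∫ x in Ω, ∫ z, (-lipDiv p x) z ∂(u x : Measure X)
      = -∫ x in U, euclideanDiv (fun y => WithLp.toLp 2 fun i =>
          Lip0.integralCLM x₀ uplus (p y i) - Lip0.integralCLM x₀ uminus (p y i)) x := by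
  set L₁ := Lip0.integralCLM x₀ uplus
  set L₂ := Lip0.integralCLM x₀ uminus
  have h1 : ∀ x ∈ Ω, ∫ z, (-lipDiv p x) z ∂(u x : Measure X)
      = -(L₂ (lipDiv p x) + U.indicator (fun x => (L₁ - L₂) (lipDiv p x)) x) := fun x hx => by
    rw [← Lip0.integralCLM_apply, map_neg]
    by_cases hxU : x ∈ U
    · rw [hu_plus x hxU, indicator_of_mem hxU, sub_apply, add_sub_cancel]
    · rw [hu_minus x ⟨hx, hxU⟩, indicator_of_notMem hxU, add_zero]
  rw [setIntegral_congr_fun hΩ.measurableSet h1, integral_neg, integral_add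
    (integrable_map_lipDiv L₂ hp hpc).integrableOn
    ((integrable_map_lipDiv (L₁ - L₂) hp hpc).indicator hUm).integrableOn,
    setIntegral_eq_integral_of_forall_compl_eq_zero fun x hx => ?_,
    integral_map_lipDiv_eq_zero L₂ hp hpc, zero_add, setIntegral_indicator hUm,
    inter_eq_self_of_subset_right hUΩ]
  · simp only [map_lipDiv (L₁ - L₂) hp]
    rfl
  · rw [lipDiv_eq_zero_of_notMem_tsupport fun h => hx (hpΩ h), map_zero]

theorem TVKR_le (hΩ : IsOpen Ω) (hUm : MeasurableSet U) (hUc : IsCompact (closure U))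
    (hUΩ : closure U ⊆ Ω) (hU : HasC1Boundary U)
    (hu_plus : ∀ x ∈ U, u x = uplus) (hu_minus : ∀ x ∈ Ω \ U, u x = uminus)
    {N : (Fin d → Lip0 x₀) → ℝ} (hN : ∀ p, coupledLipNorm p ≤ N p) :
    TVKR Ω x₀ N u ≤ (((μHE[d - 1] (frontier U)).toReal * (wasserstein1 uplus uminus).toReal : ℝ) :
      EReal) := by
  have hfc : IsCompact (frontier U) := hUc.of_isClosed_subset isClosed_frontier frontier_subset_closure
  refine iSup_le fun p => iSup_le fun hp => iSup_le fun hpc => iSup_le fun hpΩ => iSup_le fun hpN => ?_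
  rw [EReal.coe_le_coe_iff, integral_lipDiv_eq hΩ hUm (subset_closure.trans hUΩ) hu_plus hu_minus
    hp hpc hpΩ, mul_comm]
  refine (neg_le_abs _).trans (hU.integral_euclideanDiv_le hUm hfc ?_ ?_ fun x => ?_)
  · exact (contDiff_piLp 2).2 fun i =>
      (contDiff_apply_lip0 _ hp i).sub (contDiff_apply_lip0 _ hp i)
  · refine hpc.comp_left (g := fun z : Fin d → Lip0 x₀ => WithLp.toLp 2 fun i =>
      Lip0.integralCLM x₀ uplus (z i) - Lip0.integralCLM x₀ uminus (z i)) ?_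
    ext i
    simp
  · refine norm_integralCLM_sub_le uplus uminus (p x) ?_
    by_cases hx : x ∈ Ω
    · exact (hN _).trans (hpN x hx)
    · rw [image_eq_zero_of_notMem_tsupport fun h => hx (hpΩ h)]
      refine (coupledLipNorm_le_productLipNorm _).trans ?_
      simp [productLipNorm]

theorem le_TVKR (hΩ : IsOpen Ω) (hUm : MeasurableSet U) (hUc : IsCompact (closure U))
    (hUΩ : closure U ⊆ Ω) (hU : HasC1Boundary U)
    (hu_plus : ∀ x ∈ U, u x = uplus) (hu_minus : ∀ x ∈ Ω \ U, u x = uminus)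
    {N : (Fin d → Lip0 x₀) → ℝ} (hN : ∀ p, N p ≤ productLipNorm p) :
    (((μHE[d - 1] (frontier U)).toReal * (wasserstein1 uplus uminus).toReal : ℝ) : EReal)
      ≤ TVKR Ω x₀ N u := by
  have hfc : IsCompact (frontier U) := hUc.of_isClosed_subset isClosed_frontier frontier_subset_closure
  have hval : ∀ p : EuclideanSpace ℝ (Fin d) → Fin d → Lip0 x₀, ContDiff ℝ 1 p →
      HasCompactSupport p → tsupport p ⊆ Ω → (∀ x, productLipNorm (p x) ≤ 1) →
      ((-∫ x in U, euclideanDiv (fun y => WithLp.toLp 2 fun i =>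
          Lip0.integralCLM x₀ uplus (p y i) - Lip0.integralCLM x₀ uminus (p y i)) x : ℝ) : EReal)
        ≤ TVKR Ω x₀ N u := fun p hp hpc hpΩ hpN => by
    rw [← integral_lipDiv_eq hΩ hUm (subset_closure.trans hUΩ) hu_plus hu_minus hp hpc hpΩ]
    exact le_iSup_of_le p (le_iSup_of_le hp (le_iSup_of_le hpc (le_iSup_of_le hpΩ
      (le_iSup_of_le (fun x _ => (hN _).trans (hpN x)) le_rfl))))
  set h := (μHE[d - 1] (frontier U)).toReal
  set w := (wasserstein1 uplus uminus).toReal with hw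
  have hh0 : 0 ≤ h := ENNReal.toReal_nonneg
  have hw0 : 0 ≤ w := ENNReal.toReal_nonneg
  -- If either factor is zero, the zero field already attains the bound. Otherwise `ε` can be taken
  -- below both factors, so the approximate factors stay nonnegative when multiplied.
  rcases hh0.eq_or_lt with hh | hh
  · rw [← hh, zero_mul]
    simpa [euclideanDiv] using hval 0 contDiff_const HasCompactSupport.zero (by simp)
      (by simp [productLipNorm])
  rcases hw0.eq_or_lt with hw' | hw'
  · rw [← hw', mul_zero]
    simpa [euclideanDiv] using hval 0 contDiff_const HasCompactSupport.zero (by simp)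
      (by simp [productLipNorm])
  have hlim : Tendsto (fun ε : ℝ => (((h - ε) * (w - ε) : ℝ) : EReal)) (𝓝[>] 0)
      (𝓝 ((h * w : ℝ) : EReal)) := by
    have hc : Continuous fun ε : ℝ => (((h - ε) * (w - ε) : ℝ) : EReal) :=
      continuous_coe_real_ereal.comp (by fun_prop)
    simpa using (hc.tendsto 0).mono_left nhdsWithin_le_nhds
  refine le_of_tendsto hlim ?_
  filter_upwards [Ioo_mem_nhdsGT (lt_min hh hw')] with ε hε
  have hεh := (lt_min_iff.1 hε.2).1
  have hεw := (lt_min_iff.1 hε.2).2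
  obtain ⟨ψ, hψ, hψc, hψΩ, hψ1, hψU⟩ := hU.exists_le_integral_euclideanDiv hUm hfc hΩ
    (frontier_subset_closure.trans hUΩ) hε.1
  obtain ⟨q, hq, hqw⟩ := exists_lip0_le_integral_sub x₀ uplus uminus (c := w - ε) (by
    rw [ENNReal.ofReal_lt_iff_lt_toReal (by linarith) (wasserstein1_lt_top _ _).ne]
    linarith [hε.1])
  set D := Lip0.integralCLM x₀ uplus q - Lip0.integralCLM x₀ uminus q
  -- The sign compensates the one in front of the divergence in `TVKR`.
  let P : EuclideanSpace ℝ (Fin d) → Fin d → Lip0 x₀ := fun z i => -(z i • q)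
  have hP0 : P 0 = 0 := by
    ext i : 1
    simp [P]
  have h1 := hval (P ∘ ψ) (contDiff_pi.2 fun i => (((contDiff_piLp 2).1 hψ i).smul
    contDiff_const).neg) (hψc.comp_left hP0) ((tsupport_comp_subset hP0 ψ).trans hψΩ) (fun x => by
      refine le_trans (Real.sqrt_le_sqrt (Finset.sum_le_sum fun i _ => ?_))
        ((EuclideanSpace.norm_eq (ψ x)).symm.le.trans (hψ1 x))
      refine pow_le_pow_left₀ (norm_nonneg _) ?_ 2
      simp only [P, Function.comp_apply, norm_neg, norm_smul]
      exact mul_le_of_le_one_right (norm_nonneg _) hq)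
  have h2 : ∀ x, euclideanDiv (fun y => WithLp.toLp 2 fun i => Lip0.integralCLM x₀ uplus ((P ∘ ψ) y i)
      - Lip0.integralCLM x₀ uminus ((P ∘ ψ) y i)) x = -D * euclideanDiv ψ x := fun x => by
    rw [euclideanDiv, euclideanDiv, Finset.mul_sum]
    refine Finset.sum_congr rfl fun i _ => ?_
    have h3 : (fun y => (WithLp.toLp 2 fun i => Lip0.integralCLM x₀ uplus ((P ∘ ψ) y i)
      - Lip0.integralCLM x₀ uminus ((P ∘ ψ) y i) : EuclideanSpace ℝ (Fin d)) i)
        = fun y => -D * ψ y i := by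
      ext y
      simp only [P, D, Function.comp_apply, map_neg, map_smul, smul_eq_mul]
      ring
    rw [h3, fderiv_const_mul (((contDiff_piLp 2).1 hψ i).differentiable one_ne_zero x)]
    rfl
  simp only [h2] at h1
  rw [integral_const_mul, neg_mul, neg_neg] at h1
  refine le_trans (EReal.coe_le_coe_iff.2 ?_) h1
  rw [mul_comm]
  exact mul_le_mul hqw.le hψU (by linarith) (by linarith)

end TV

end

theorem mainTheorem5 (d : ℕ) (hd : 1 ≤ d) (Ω U : Set (EuclideanSpace ℝ (Fin d)))
    (hΩ : IsOpen Ω) (hΩb : Bornology.IsBounded Ω)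
    (hUm : MeasurableSet U) (hUc : IsCompact (closure U)) (hUΩ : closure U ⊆ Ω)
    (hU : HasC1Boundary U) (x₀ : S2) (uplus uminus : ProbabilityMeasure S2)
    (u : EuclideanSpace ℝ (Fin d) → ProbabilityMeasure S2)
    (hu_plus : ∀ x ∈ U, u x = uplus) (hu_minus : ∀ x ∈ Ω \ U, u x = uminus) :
    TVKR Ω x₀ coupledLipNorm u
        = ((μHE[d - 1] (frontier U) * wasserstein1 uplus uminus : ℝ≥0∞) : EReal) ∧
      TVKR Ω x₀ productLipNorm u
        = ((μHE[d - 1] (frontier U) * wasserstein1 uplus uminus : ℝ≥0∞) : EReal) := by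
  have hfc : IsCompact (frontier U) := hUc.of_isClosed_subset isClosed_frontier frontier_subset_closure
  have hfin := hU.euclideanHausdorffMeasure_frontier_lt_top hUm hfc
  -- Both factors are finite, so the product in `ℝ≥0∞` is the real product used in the two bounds.
  have hval : ((μHE[d - 1] (frontier U) * wasserstein1 uplus uminus : ℝ≥0∞) : EReal)
      = (((μHE[d - 1] (frontier U)).toReal * (wasserstein1 uplus uminus).toReal : ℝ) : EReal) := by
    rw [← ENNReal.toReal_mul, ← EReal.toReal_coe_ennreal, EReal.coe_toReal _
      (EReal.coe_ennreal_ne_bot _)]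
    rw [Ne, EReal.coe_ennreal_eq_top_iff]
    exact ENNReal.mul_ne_top hfin.ne (wasserstein1_lt_top _ _).ne
  rw [hval]
  have hle : ∀ p : Fin d → Lip0 x₀, coupledLipNorm p ≤ productLipNorm p :=
    coupledLipNorm_le_productLipNorm
  exact ⟨le_antisymm (TVKR_le hΩ hUm hUc hUΩ hU hu_plus hu_minus fun _ => le_rfl)
      (le_TVKR hΩ hUm hUc hUΩ hU hu_plus hu_minus hle),
    le_antisymm (TVKR_le hΩ hUm hUc hUΩ hU hu_plus hu_minus hle)
      (le_TVKR hΩ hUm hUc hUΩ hU hu_plus hu_minus fun _ => le_rfl)⟩
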